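/- Let $p$ be a prime, $k$ a field of characteristic $p$ and $G$ a finite group; all modules are finitely generated. A $kG$-module is a *$p$-permutation module* if its restriction to every $p$-subgroup $P$ of $G$ has a $k$-basis permuted by $P$. For a normal subgroup $P$ of $G$ the Brauer construction of a $kG$-module $M$ is the $k[G/P]$-module $M(P)=M^P/\sum_{Q<P}\operatorname{tr}_Q^P(M^Q)$, where $\operatorname{tr}_Q^P(m)=\sum_{x\in[P/Q]}xm$; it is applied to chain complexes termwise. A bounded chain complex $C$ of $p$-permutation $kG$-modules is *endotrivial* if $C^*\otimes_k C\simeq k[0]$ (homotopy equivalence of complexes of $kG$-modules, with $k[0]$ the trivial module in degree $0$), and an endotrivial complex $C$ is *faithful* if moreover $C(P)\simeq k[0]$ as complexes of $k[G/P]$-modules for every nontrivial normal $p$-subgroup $P$ of $G$. A $kG$-module is *$H$-projective* ($H\le G$) if it is a direct summand of $\operatorname{Ind}_H^G N$ for some $kH$-module $N$; for a set $\mathcal X$ of subgroups it is *$\mathcal X$-projective* if each of its indecomposable direct summands is $H$-projective for some $H\in\mathcal X$ (so the zero module is $\mathcal X$-projective). A *vertex* of an indecomposable module is a subgroup $P$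 that is minimal among the subgroups $H$ for which the module is $H$-projective. Let $\mathcal X$ be the set of all $p$-subgroups of $G$ that contain no nontrivial normal subgroup of $G$, and let $C$ be a faithful endotrivial complex of $kG$-modules. Then $C$ is homotopy equivalent to a bounded chain complex $D$ of $p$-permutation $kG$-modules for which there is an integer $i$ such that $D_j$ is $\mathcal X$-projective for all $j\neq i$, and $D_i\cong M\oplus N$, where $M$ is $\mathcal X$-projective (possibly $0$) and $N$ is an indecomposable $kG$-module whose vertices are exactly the Sylow $p$-subgroups of $G$. -/

import Mathlib

open CategoryTheory CategoryTheory.Limits MonoidalCategory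

universe u

namespace EndotrivialComplex

/-! ### Relative traces and the Brauer construction -/

section Brauer

variable {k G V W : Type*} [Field k] [Group G] [AddCommGroup V] [Module k V]
  [AddCommGroup W] [Module k W]

/-- The relative trace `tr_Q^P m = ∑_{x ∈ [P/Q]} x • m`, for `Q ≤ P` and `m` fixed by `Q`. -/
noncomputable def relTrace (ρ : Representation k G V) (Q P : Subgroup G) (m : V) : V :=
  ∑ᶠ x : P ⧸ Q.subgroupOf P, ρ (x.out : P) m

/-- The submodule `∑_{Q < P} tr_Q^P (M^Q)` of `M^P`. -/
noncomputable def traceSubmodule (ρ : Representation k G V) (P : Subgroup G) :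
    Submodule k (Representation.invariants (ρ.comp P.subtype)) :=
  Submodule.span k
    {v | ∃ Q : Subgroup G, Q < P ∧ ∃ m : V, (∀ q ∈ Q, ρ q m = m) ∧ (v : V) = relTrace ρ Q P m}

theorem relTrace_conj [Finite G] (ρ : Representation k G V) (Q P : Subgroup G) [P.Normal] (m : V)
    (hm : ∀ q ∈ Q, ρ q m = m) (g : G) :
    ρ g (relTrace ρ Q P m) = relTrace ρ (Q.map (MulAut.conj g).toMonoidHom) P (ρ g m) := by
  classical
  have hmem : ∀ (a : P ⧸ Q.subgroupOf P) (b : P), (QuotientGroup.mk b) = a →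
      ρ (a.out : P) m = ρ (b : G) m := by
    intro a b hab
    have h1 : (QuotientGroup.mk b : P ⧸ Q.subgroupOf P) = QuotientGroup.mk a.out := by
      rw [hab]; exact (QuotientGroup.out_eq' a).symm
    have h2 := QuotientGroup.eq.1 h1
    rw [Subgroup.mem_subgroupOf] at h2
    have h3 := hm _ h2
    have h4 : ρ (b : G) (ρ ((b⁻¹ * a.out : P) : G) m) = ρ (b : G) m := by rw [h3]
    rw [← h4, ← Module.End.mul_apply, ← map_mul]
    simp
  have hmem' : ∀ (a : P ⧸ (Q.map (MulAut.conj g).toMonoidHom).subgroupOf P) (b : P),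
      (QuotientGroup.mk b) = a → ρ (a.out : P) (ρ g m) = ρ (b : G) (ρ g m) := by
    intro a b hab
    have h1 : (QuotientGroup.mk b : P ⧸ (Q.map (MulAut.conj g).toMonoidHom).subgroupOf P) =
        QuotientGroup.mk a.out := by
      rw [hab]; exact (QuotientGroup.out_eq' a).symm
    have h2 := QuotientGroup.eq.1 h1
    rw [Subgroup.mem_subgroupOf] at h2
    obtain ⟨q, hq, hq'⟩ := h2
    have h3 : ρ ((b⁻¹ * a.out : P) : G) (ρ g m) = ρ g m := by
      rw [← hq']
      rw [← Module.End.mul_apply, ← map_mul]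
      have : ((MulAut.conj g).toMonoidHom q) * g = g * q := by simp
      rw [this, map_mul, Module.End.mul_apply, hm q hq]
    have h4 : ρ (b : G) (ρ ((b⁻¹ * a.out : P) : G) (ρ g m)) = ρ (b : G) (ρ g m) := by rw [h3]
    rw [← h4, ← Module.End.mul_apply (ρ (b : G)), ← map_mul]
    simp
  let c : P ≃ P := (MulAut.conjNormal g : MulAut P).toEquiv
  have hc : ∀ x : P, ((c x : P) : G) = g * x * g⁻¹ := fun x => MulAut.conjNormal_apply g x
  let e : (P ⧸ Q.subgroupOf P) ≃ (P ⧸ (Q.map (MulAut.conj g).toMonoidHom).subgroupOf P) :=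
    Quotient.congr c (by
      intro a b
      rw [QuotientGroup.leftRel_apply, QuotientGroup.leftRel_apply, Subgroup.mem_subgroupOf,
        Subgroup.mem_subgroupOf]
      have : (((c a)⁻¹ * c b : P) : G) = (MulAut.conj g).toMonoidHom ((a⁻¹ * b : P) : G) := by
        simp [hc, mul_assoc]
      rw [this, Subgroup.mem_map_iff_mem (MulAut.conj g).injective])
  unfold relTrace
  rw [map_finsum (ρ g) (Set.toFinite _)]
  refine finsum_eq_of_bijective e e.bijective ?_
  intro x
  have hx : (QuotientGroup.mk (c x.out) :
      P ⧸ (Q.map (MulAut.conj g).toMonoidHom).subgroupOf P) = e x := by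
    conv_rhs => rw [← QuotientGroup.out_eq' x]
    rfl
  rw [hmem' (e x) (c x.out) hx, hc]
  rw [← Module.End.mul_apply, ← Module.End.mul_apply, ← map_mul, ← map_mul]
  simp

theorem relTrace_map [Finite G] {ρ : Representation k G V} {σ : Representation k G W}
    (f : ρ.IntertwiningMap σ) (Q P : Subgroup G) (m : V) :
    f.toLinearMap (relTrace ρ Q P m) = relTrace σ Q P (f.toLinearMap m) := by
  unfold relTrace
  rw [map_finsum f.toLinearMap (Set.toFinite _)]
  refine finsum_congr fun x => ?_
  exact LinearMap.congr_fun (f.isIntertwining' _) m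

theorem traceSubmodule_le_comap [Finite G] (ρ : Representation k G V) (P : Subgroup G) [P.Normal]
    (g : G ⧸ P) :
    traceSubmodule ρ P ≤ (traceSubmodule ρ P).comap (ρ.quotientToInvariants P g) := by
  induction g using QuotientGroup.induction_on with
  | H g =>
    refine Submodule.span_le.2 ?_
    rintro v ⟨Q, hQ, m, hm, hv⟩
    refine Submodule.subset_span ⟨Q.map (MulAut.conj g).toMonoidHom, ?_, ρ g m, ?_, ?_⟩
    · have hP : P.map (MulAut.conj g).toMonoidHom = P := Subgroup.Normal.map_conj_eq P g
      have := (Subgroup.map_lt_map_iff_of_injective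
        (f := (MulAut.conj g).toMonoidHom) (MulAut.conj g).injective).2 hQ
      rwa [hP] at this
    · rintro _ ⟨q, hq, rfl⟩
      rw [← Module.End.mul_apply, ← map_mul]
      have : ((MulAut.conj g).toMonoidHom q) * g = g * q := by simp
      rw [this, map_mul, Module.End.mul_apply, hm q hq]
    · rw [← relTrace_conj ρ Q P m hm g, ← hv]
      rfl

/-- The map `M^P → N^P` induced by a homomorphism `M → N`. -/
noncomputable def invariantsMap {ρ : Representation k G V} {σ : Representation k G W}
    (f : ρ.IntertwiningMap σ) (P : Subgroup G) :
    Representation.invariants (ρ.comp P.subtype) →ₗ[k]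
      Representation.invariants (σ.comp P.subtype) :=
  f.toLinearMap.restrict fun v hv p => by
    have h := LinearMap.congr_fun (f.isIntertwining' (p : G)) v
    have h' : ρ (p : G) v = v := hv p
    simp only [LinearMap.comp_apply, h'] at h
    exact h.symm

theorem traceSubmodule_le_comap_map [Finite G] {ρ : Representation k G V}
    {σ : Representation k G W} (f : ρ.IntertwiningMap σ) (P : Subgroup G) :
    traceSubmodule ρ P ≤ (traceSubmodule σ P).comap (invariantsMap f P) := by
  refine Submodule.span_le.2 ?_
  rintro v ⟨Q, hQ, m, hm, hv⟩
  refine Submodule.subset_span ⟨Q, hQ, f.toLinearMap m, ?_, ?_⟩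
  · intro q hq
    have h := LinearMap.congr_fun (f.isIntertwining' q) m
    simp only [LinearMap.comp_apply, hm q hq] at h
    exact h.symm
  · rw [← relTrace_map, ← hv]
    rfl

end Brauer

section

variable (k : Type u) {G : Type u} [Field k] [Group G]

/-- The Brauer construction `M ↦ M(P) = M^P / ∑_{Q < P} tr_Q^P (M^Q)` at a normal subgroup `P`
(so that `N_G(P) / P = G / P`), a functor from `kG`-modules to `k[G/P]`-modules. -/
noncomputable def brauer [Finite G] (P : Subgroup G) [P.Normal] :
    Rep.{u} k G ⥤ Rep.{u} k (G ⧸ P) where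
  obj M := Rep.of ((M.ρ.quotientToInvariants P).quotient (traceSubmodule M.ρ P)
    (traceSubmodule_le_comap M.ρ P))
  map {M N} f := Rep.ofHom ⟨Submodule.mapQ _ _ (invariantsMap f.hom P)
      (traceSubmodule_le_comap_map f.hom P), fun g => by
    induction g using QuotientGroup.induction_on with
    | H g =>
      refine Submodule.linearMap_qext _ (LinearMap.ext fun v => ?_)
      refine congrArg (Submodule.Quotient.mk) (Subtype.ext ?_)
      exact LinearMap.congr_fun (f.hom.isIntertwining' g) (v : M.V)⟩
  map_id M := by
    refine Rep.hom_ext (Representation.IntertwiningMap.ext (LinearMap.ext fun v => ?_))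
    obtain ⟨v, rfl⟩ := Submodule.Quotient.mk_surjective _ v
    rfl
  map_comp f g := by
    refine Rep.hom_ext (Representation.IntertwiningMap.ext (LinearMap.ext fun v => ?_))
    obtain ⟨v, rfl⟩ := Submodule.Quotient.mk_surjective _ v
    rfl

instance [Finite G] (P : Subgroup G) [P.Normal] : (brauer k P).Additive where
  map_add {M N f g} := by
    refine Rep.hom_ext (Representation.IntertwiningMap.ext (LinearMap.ext fun v => ?_))
    obtain ⟨v, rfl⟩ := Submodule.Quotient.mk_surjective _ v
    rfl

/-! ### Duals and tensor products of chain complexes -/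

variable (G) in
/-- The chain complex `k[0]`: the trivial `kG`-module in degree `0`. -/
noncomputable def trivialComplex : ChainComplex (Rep.{u} k G) ℤ :=
  (HomologicalComplex.single (Rep.{u} k G) (ComplexShape.down ℤ) 0).obj (Rep.trivial k G k)

variable {k}

/-- The dual `M^* = Hom_k(M, k)` of a `kG`-module. -/
noncomputable def dual (M : Rep.{u} k G) : Rep.{u} k G := Rep.of M.ρ.dual

/-- The transpose of a homomorphism of `kG`-modules. -/
noncomputable def dualMap {M N : Rep.{u} k G} (f : M ⟶ N) : dual N ⟶ dual M :=
  Rep.ofHom ⟨f.hom.toLinearMap.dualMap, fun g => by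
    refine LinearMap.ext fun φ => LinearMap.ext fun v => ?_
    exact congrArg φ (LinearMap.congr_fun (f.hom.isIntertwining' g⁻¹).symm v)⟩

theorem dualMap_zero {M N : Rep.{u} k G} : dualMap (0 : M ⟶ N) = 0 := by
  refine Rep.hom_ext (Representation.IntertwiningMap.ext
    (LinearMap.ext fun φ => LinearMap.ext fun v => ?_))
  exact LinearMap.map_zero (show N.V →ₗ[k] k from φ)

theorem dualMap_comp {M N L : Rep.{u} k G} (f : M ⟶ N) (g : N ⟶ L) :
    dualMap (f ≫ g) = dualMap g ≫ dualMap f := rfl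

/-- The dual complex `C^* = Hom_k(C, k[0])`: its term in degree `n` is `(C_{-n})^*`, and its
differential `(C_{-n})^* → (C_{-n+1})^*` is `(-1)^{n+1}` times precomposition with the
differential `C_{-n+1} → C_{-n}`. -/
noncomputable def dualComplex (C : ChainComplex (Rep.{u} k G) ℤ) :
    ChainComplex (Rep.{u} k G) ℤ where
  X n := dual (C.X (-n))
  d i j := (i + 1).negOnePow • dualMap (C.d (-j) (-i))
  shape i j hij := by
    have h : ¬ (ComplexShape.down ℤ).Rel (-j) (-i) := by
      simp only [ComplexShape.down_Rel] at hij ⊢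
      omega
    rw [C.shape _ _ h, dualMap_zero, smul_zero]
  d_comp_d' i j l _ _ := by
    rw [Linear.units_smul_comp, Linear.comp_units_smul, ← dualMap_comp, C.d_comp_d, dualMap_zero,
      smul_zero, smul_zero]

/-- The usual sign `(-1)^i` in front of `id ⊗ d` on `C_i ⊗ D_j`. -/
instance tensorSignsDownInt : (ComplexShape.down ℤ).TensorSigns where
  ε' := MonoidHom.mk' Int.negOnePow Int.negOnePow_add
  rel_add p q r hpq := by
    simp only [ComplexShape.down_Rel] at hpq ⊢
    omega
  add_rel p q r hpq := by
    simp only [ComplexShape.down_Rel] at hpq ⊢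
    omega
  ε'_succ p q hpq := by
    simp only [ComplexShape.down_Rel] at hpq
    subst hpq
    change q.negOnePow = - (q + 1).negOnePow
    rw [Int.negOnePow_succ, neg_neg]

/-! ### `p`-permutation modules, relative projectivity, vertices -/

/-- `M` is a finitely generated `p`-permutation module: it is finite dimensional and, for every
`p`-subgroup `P`, has a `k`-basis that is permuted by `P`. -/
def IsPPermutation (p : ℕ) (M : Rep.{u} k G) : Prop :=
  Module.Finite k M.V ∧ ∀ P : Subgroup G, IsPGroup p P →
    ∃ B : Set M.V, LinearIndepOn k id B ∧ Submodule.span k B = ⊤ ∧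
      ∀ g ∈ P, ∀ b ∈ B, M.ρ g b ∈ B

/-- `M` is relatively `H`-projective: a direct summand of `Ind_H^G N` for some finitely generated
`kH`-module `N`. -/
def IsRelProjective (H : Subgroup G) (M : Rep.{u} k G) : Prop :=
  ∃ N : Rep.{u} k H, Module.Finite k N.V ∧ Nonempty (Retract M (Rep.ind H.subtype N))

/-- `M` is `𝒳`-projective: each indecomposable direct summand of `M` is `H`-projective for some
`H ∈ 𝒳`. (This holds if `M = 0`.) -/
def IsRelProjectiveSet (𝒳 : Set (Subgroup G)) (M : Rep.{u} k G) : Prop :=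
  ∀ U : Rep.{u} k G, Indecomposable U → Nonempty (Retract U M) →
    ∃ H ∈ 𝒳, IsRelProjective H U

/-- `P` is a vertex of `M`: it is minimal among the subgroups relative to which `M` is projective.
(Used for indecomposable `M`.) -/
def IsVertex (P : Subgroup G) (M : Rep.{u} k G) : Prop :=
  Minimal (fun H : Subgroup G => IsRelProjective H M) P

/-! ### Endotrivial complexes -/

/-- `C` is a bounded chain complex of finitely generated `p`-permutation `kG`-modules. -/
def IsBoundedPPermutation (p : ℕ) (C : ChainComplex (Rep.{u} k G) ℤ) : Prop :=
  (∃ a b : ℤ, ∀ i, i < a ∨ b < i → IsZero (C.X i)) ∧ ∀ i, IsPPermutation p (C.X i)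

/-- `C` is an endotrivial complex: a bounded complex of finitely generated `p`-permutation modules
with `C^* ⊗ C ≃ k[0]`. -/
def IsEndotrivial (p : ℕ) (C : ChainComplex (Rep.{u} k G) ℤ) : Prop :=
  IsBoundedPPermutation p C ∧
    Nonempty (HomotopyEquiv (HomologicalComplex.tensorObj (dualComplex C) C) (trivialComplex k G))

/-- `C` is a faithful endotrivial complex: `C` is endotrivial, and `C(P) ≃ k[0]` as complexes of
`k[G/P]`-modules for every nontrivial normal `p`-subgroup `P` of `G`. -/
def IsFaithfulEndotrivial [Finite G] (p : ℕ) (C : ChainComplex (Rep.{u} k G) ℤ) : Prop :=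
  IsEndotrivial p C ∧ ∀ (P : Subgroup G) [P.Normal], IsPGroup p P → P ≠ ⊥ →
    Nonempty (HomotopyEquiv (((brauer k P).mapHomologicalComplex (ComplexShape.down ℤ)).obj C)
      (trivialComplex k (G ⧸ P)))

end

/-- The set of `p`-subgroups of `G` which contain no nontrivial normal subgroup of `G`. -/
def corefreePSubgroups (p : ℕ) (G : Type u) [Group G] : Set (Subgroup G) :=
  {P | IsPGroup p P ∧ ∀ N : Subgroup G, N.Normal → N ≤ P → N = ⊥}

end EndotrivialComplex

open EndotrivialComplex

/-! There are two cases, according to whether `G` has a nontrivial normal `p`-subgroup.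

Suppose it has none. Then `corefreePSubgroups p G` contains the Sylow `p`-subgroups, relative to
which every finite-dimensional module is projective, so `D = C` works as soon as some `C_i` has an
indecomposable summand whose vertices are the Sylow subgroups. Since `C^* ⊗ C ≃ k[0]`, the trivial
module is a summand of the degree-zero term `⨁ C_{-i}^* ⊗ C_{-i}`, so for some `i` there is a
nonzero composite `k → C_{-i}^* ⊗ C_{-i} → k`. Such a composite is the trace of an endomorphism of
`C_{-i}`, and a nonzero trace survives on an indecomposable summand `N`. By Higman's criterion, if
`N` is `H`-projective its identity is a relative trace from `H`, so every trace of an endomorphism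
is a multiple of `[G : H]`; hence `p ∤ [G : H]`.

Suppose there is a nontrivial normal `p`-subgroup `P₀`. Replace `C` by a homotopy equivalent `D`
without contractible summands (`Rep.exists_minimal`), and take `i = 0` and `N = k`. An
indecomposable `p`-permutation module is a summand of some `k[G/Q]`, so either `Q` is corefree or a
nontrivial normal `p`-subgroup `P ≤ Q` acts trivially (`Rep.isRelProjective_or_acts_trivially`). The
second kind is controlled by `D(P) ≃ k[0]`. The Brauer functor at `P` is full on `p`-permutation
modules (`Rep.exists_brauer_map_eq`) and faithful on modules with trivial `P`-action
(`Rep.eq_zero_of_brauer_map_eq_zero`), so the homotopies lift to `D`. On a summand `U` with trivial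
`P`-action the lifted homotopy terms are not invertible, by minimality, so locality of `End U`
leaves only the part that factors through `k[0]` (`Rep.isIso_of_brauer_map_eq`). No such `U` occurs
in a nonzero degree. In degree zero `U` embeds in `k`, so `P₀` acts trivially on it too, and it
cannot lie in the complement of the copy of `k` split off by means of `P₀`. -/

section Idempotents

/-! ### Idempotents and direct summands in abelian categories. -/

variable {𝒞 : Type*} [Category 𝒞] [Abelian 𝒞]

theorem CategoryTheory.exists_split_idempotent {X : 𝒞} (e : X ⟶ X) (he : e ≫ e = e) :
    ∃ (Y : 𝒞) (i : Y ⟶ X) (q : X ⟶ Y), i ≫ q = 𝟙 Y ∧ q ≫ i = e :=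
  IsIdempotentComplete.idempotents_split X e he

/-- Maps exhibiting `X` as the direct sum of `Y` and `Z` give an isomorphism with the biproduct. -/
noncomputable def CategoryTheory.isoBiprod {X Y Z : 𝒞} (i : Y ⟶ X) (q : X ⟶ Y) (j : Z ⟶ X)
    (r : X ⟶ Z) (hiq : i ≫ q = 𝟙 Y) (hjr : j ≫ r = 𝟙 Z) (h : q ≫ i + r ≫ j = 𝟙 X) :
    X ≅ Y ⊞ Z where
  hom := biprod.lift q r
  inv := biprod.desc i j
  hom_inv_id := by rw [biprod.lift_desc, h]
  inv_hom_id := by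
    have hir : i ≫ r = 0 := by
      have := congrArg (fun f => i ≫ f ≫ r) h
      simp only [Preadditive.add_comp, Preadditive.comp_add, Category.assoc, hjr,
        Category.id_comp, Category.comp_id] at this
      rw [← Category.assoc i q, hiq] at this
      simpa using this
    have hjq : j ≫ q = 0 := by
      have := congrArg (fun f => j ≫ f ≫ q) h
      simp only [Preadditive.add_comp, Preadditive.comp_add, Category.assoc, hiq,
        Category.id_comp, Category.comp_id] at this
      rw [← Category.assoc j r, hjr] at this
      simpa using this
    ext <;> simp [hiq, hjr, hir, hjq]

theorem CategoryTheory.Indecomposable.eq_zero_or_eq_id {U : 𝒞} (hU : Indecomposable U)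
    (e : U ⟶ U) (he : e ≫ e = e) : e = 0 ∨ e = 𝟙 U := by
  have he' : (𝟙 U - e) ≫ (𝟙 U - e) = 𝟙 U - e := by simp [he]
  obtain ⟨Y, i, q, hi, hq⟩ := exists_split_idempotent e he
  obtain ⟨Z, j, r, hj, hr⟩ := exists_split_idempotent _ he'
  rcases hU.2 Y Z (isoBiprod i q j r hi hj (by rw [hq, hr]; abel)) with h | h
  · left; rw [← hq, h.eq_of_tgt q 0, zero_comp]
  · right
    rw [h.eq_of_tgt r 0, zero_comp] at hr
    exact (sub_eq_zero.1 hr.symm).symm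

theorem CategoryTheory.indecomposable_of_idempotents {U : 𝒞} (h0 : ¬ IsZero U)
    (h : ∀ e : U ⟶ U, e ≫ e = e → e = 0 ∨ e = 𝟙 U) : Indecomposable U := by
  refine ⟨h0, fun Y Z φ => ?_⟩
  have key : ∀ f : Y ⟶ Y, biprod.inl ≫ φ.inv ≫ (φ.hom ≫ biprod.fst ≫ f ≫ biprod.inl ≫ φ.inv) ≫
      φ.hom ≫ biprod.fst = f := by simp
  rcases h (φ.hom ≫ biprod.fst ≫ biprod.inl ≫ φ.inv) (by simp) with h | h
  · left
    rw [IsZero.iff_id_eq_zero]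
    have := key (𝟙 Y)
    rw [Category.id_comp, h] at this
    simpa using this.symm
  · right
    rw [IsZero.iff_id_eq_zero]
    have : biprod.inr ≫ φ.inv ≫ (φ.hom ≫ biprod.fst ≫ biprod.inl ≫ φ.inv) ≫ φ.hom ≫ biprod.snd =
      (0 : Z ⟶ Z) := by simp
    rw [h] at this
    simpa using this

theorem CategoryTheory.Retract.exists_complement {U X : 𝒞} (h : Retract U X) :
    ∃ (M : 𝒞) (m : M ⟶ X) (q : X ⟶ M), m ≫ q = 𝟙 M ∧ q ≫ m + h.r ≫ h.i = 𝟙 X ∧ m ≫ h.r = 0 := by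
  have he : (𝟙 X - h.r ≫ h.i) ≫ (𝟙 X - h.r ≫ h.i) = 𝟙 X - h.r ≫ h.i := by simp
  obtain ⟨M, m, q, hm, hq⟩ := exists_split_idempotent _ he
  refine ⟨M, m, q, hm, by rw [hq]; abel, ?_⟩
  have : m ≫ (q ≫ m) ≫ h.r = 0 := by rw [hq]; simp
  rwa [Category.assoc, ← Category.assoc, hm, Category.id_comp] at this

end Idempotents

/-! ### Fitting's lemma and local endomorphism rings. -/

section Local

/-- Fitting's lemma: factor an annihilating polynomial as `X ^ n * q` with `q` prime to `X`. A
Bézout relation produces an idempotent in `k[f]`; if it is `1` then `f` is invertible, and if it is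
`0` then `f ^ n = 0`. -/
theorem isUnit_or_isNilpotent_of_idempotents {k A : Type*} [Field k] [Ring A] [Algebra k A]
    (h : ∀ e : A, e * e = e → e = 0 ∨ e = 1) (f : A) (hf : IsIntegral k f) :
    IsUnit f ∨ IsNilpotent f := by
  classical
  obtain ⟨p, hp, hpf⟩ := hf
  rw [← Polynomial.aeval_def] at hpf
  -- The extra factor `X` guarantees `n ≠ 0`, which is needed to pass from `f ^ n` invertible to `f`
  -- invertible.
  have hp0 : Polynomial.X * p ≠ 0 := mul_ne_zero Polynomial.X_ne_zero hp.ne_zero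
  obtain ⟨q, hq, hq'⟩ := Polynomial.exists_eq_pow_rootMultiplicity_mul_and_not_dvd
    (Polynomial.X * p) hp0 0
  set n := Polynomial.rootMultiplicity 0 (Polynomial.X * p)
  rw [map_zero, sub_zero] at hq hq'
  have hn : n ≠ 0 := by
    intro hn
    rw [hn, pow_zero, one_mul] at hq
    exact hq' (hq ▸ dvd_mul_right _ _)
  have hcop : IsCoprime (Polynomial.X ^ n) q :=
    ((Polynomial.irreducible_X.coprime_iff_not_dvd).2 hq').pow_left
  obtain ⟨a, b, hab⟩ := hcop
  have hz : f ^ n * Polynomial.aeval f q = 0 := by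
    have := congrArg (Polynomial.aeval f) hq
    simp only [map_mul, map_pow, Polynomial.aeval_X, hpf, mul_zero] at this
    exact this.symm
  have hone : Polynomial.aeval f a * f ^ n + Polynomial.aeval f b * Polynomial.aeval f q = 1 := by
    have := congrArg (Polynomial.aeval f) hab
    simpa using this
  have hcomm : ∀ r s : Polynomial k, Commute (Polynomial.aeval f r) (Polynomial.aeval f s) :=
    fun r s => by rw [Commute, SemiconjBy, ← map_mul, ← map_mul, mul_comm]
  have hX : Polynomial.aeval f (Polynomial.X ^ n : Polynomial k) = f ^ n := by simp
  rcases h (Polynomial.aeval f a * f ^ n) (by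
    have e1 : (Polynomial.aeval f a * f ^ n) * (Polynomial.aeval f b * Polynomial.aeval f q) = 0 := by
      rw [(hcomm b q).eq, mul_assoc, ← mul_assoc (f ^ n), hz, zero_mul, mul_zero]
    have := congrArg (fun t => (Polynomial.aeval f a * f ^ n) * t) hone
    simpa [mul_add, e1] using this) with h0 | h1
  · right
    refine ⟨n, ?_⟩
    rw [h0, zero_add] at hone
    have := congrArg (fun t => f ^ n * t) hone
    simp only [mul_one] at this
    rw [← this, (hcomm b q).eq, ← mul_assoc, hz, zero_mul]
  · left
    have h2 : f ^ n * Polynomial.aeval f a = 1 := by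
      rw [← h1, ← hX, (hcomm _ _).eq]
    have : IsUnit (f ^ n) := ⟨⟨_, _, h2, h1⟩, rfl⟩
    exact (isUnit_pow_iff hn).1 this

end Local

namespace Rep

variable {k : Type u} {G : Type u} [Field k] [Group G]

theorem isZero_iff_subsingleton (M : Rep.{u} k G) : IsZero M ↔ Subsingleton M.V := by
  rw [IsZero.iff_id_eq_zero]
  constructor
  · intro h
    refine ⟨fun a b => ?_⟩
    have : ∀ x : M.V, x = 0 := fun x => by
      have := congrArg (fun f : M ⟶ M => f.hom x) h
      exact this
    rw [this a, this b]
  · intro h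
    ext x
    exact Subsingleton.elim _ _

theorem retract_injective {U X : Rep.{u} k G} (h : Retract U X) : Function.Injective h.i.hom := by
  intro a b hab
  have : ∀ x, h.r.hom (h.i.hom x) = x := fun x => congrArg (fun f : U ⟶ U => f.hom x) h.retract
  rw [← this a, ← this b, hab]

theorem finite_of_retract {U X : Rep.{u} k G} (h : Retract U X) [Module.Finite k X.V] :
    Module.Finite k U.V :=
  Module.Finite.of_injective h.i.hom.toLinearMap (retract_injective h)

instance finite_end (U : Rep.{u} k G) [Module.Finite k U.V] : Module.Finite k (End U) :=
  Module.Finite.of_injective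
    ({ toFun := fun f : End U => (Rep.Hom.hom f).toLinearMap
       map_add' := fun _ _ => rfl
       map_smul' := fun _ _ => rfl } : End U →ₗ[k] (U.V →ₗ[k] U.V))
    (fun _ _ h => Rep.hom_ext (Representation.IntertwiningMap.ext h))

/-- Locality of `End U`. After normalising the sum to `1`, if the first term is not a unit it is
nilpotent, and then the second is `1` minus a nilpotent. -/
theorem isIso_or_isIso_of_add {U : Rep.{u} k G} [Module.Finite k U.V] (hU : Indecomposable U)
    (f g : U ⟶ U) (h : IsIso (f + g)) : IsIso f ∨ IsIso g := by
  have hidem : ∀ e : End U, e * e = e → e = 0 ∨ e = 1 := fun e he => hU.eq_zero_or_eq_id e he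
  have h1 : (inv (f + g) ≫ f) + (inv (f + g) ≫ g) = 𝟙 U := by
    rw [← Preadditive.comp_add, IsIso.inv_hom_id]
  have key : ∀ a : U ⟶ U, IsUnit (show End U from inv (f + g) ≫ a) → IsIso a := by
    intro a ha
    have := (isUnit_iff_isIso (inv (f + g) ≫ a)).1 ha
    exact IsIso.of_isIso_comp_left (inv (f + g)) a
  rcases isUnit_or_isNilpotent_of_idempotents hidem (show End U from inv (f + g) ≫ f)
    (IsIntegral.of_finite k _) with h2 | h2
  · exact Or.inl (key f h2)
  · refine Or.inr (key g ?_)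
    rw [eq_sub_of_add_eq' h1]
    exact h2.isUnit_one_sub

theorem exists_isIso_of_sum {U : Rep.{u} k G} [Module.Finite k U.V] (hU : Indecomposable U)
    {ι : Type*} (s : Finset ι) (f : ι → (U ⟶ U)) (h : IsIso (∑ i ∈ s, f i)) :
    ∃ i ∈ s, IsIso (f i) := by
  classical
  induction s using Finset.induction with
  | empty =>
    exfalso
    apply hU.1
    rw [Finset.sum_empty] at h
    exact IsZero.of_mono_zero U U
  | insert a s ha ih =>
    rw [Finset.sum_insert ha] at h
    rcases isIso_or_isIso_of_add hU _ _ h with h | h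
    · exact ⟨a, by simp, h⟩
    · obtain ⟨i, hi, h⟩ := ih h
      exact ⟨i, by simp [hi], h⟩

end Rep

/-! ### Sums over cosets. -/

section CosetSum

variable {G A B : Type*} [Group G] [AddCommMonoid A] [AddCommMonoid B]

/-- The sum `∑_{x ∈ [G/H]} F x` over coset representatives. -/
noncomputable def cosetSum (H : Subgroup G) (F : G → A) : A :=
  ∑ᶠ x : G ⧸ H, F x.out

omit [AddCommMonoid A] in
-- Invariance under right translation by `H` makes the choice of coset representatives irrelevant.
theorem apply_out_mk {H : Subgroup G} {F : G → A} (hF : ∀ g, ∀ h ∈ H, F (g * h) = F g) (g : G) :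
    F (QuotientGroup.mk g : G ⧸ H).out = F g := by
  have h1 : (QuotientGroup.mk g : G ⧸ H) = QuotientGroup.mk (QuotientGroup.mk g : G ⧸ H).out :=
    (QuotientGroup.out_eq' _).symm
  have h2 := hF g _ (QuotientGroup.eq.1 h1)
  rwa [mul_inv_cancel_left] at h2

theorem cosetSum_mul_left {H : Subgroup G} {F : G → A}
    (hF : ∀ g, ∀ h ∈ H, F (g * h) = F g) (g : G) :
    cosetSum H (fun x => F (g * x)) = cosetSum H F := by
  unfold cosetSum
  refine finsum_eq_of_bijective (MulAction.toPerm g : Equiv.Perm (G ⧸ H)) (Equiv.bijective _) ?_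
  intro x
  change F (g * x.out) = _
  rw [← apply_out_mk hF (g * x.out)]
  congr 1
  conv_rhs => rw [← QuotientGroup.out_eq' x]
  rfl

variable [Finite G]

theorem cosetSum_sum {H : Subgroup G} {ι : Type*} (s : Finset ι) (F : ι → G → A) :
    cosetSum H (fun x => ∑ i ∈ s, F i x) = ∑ i ∈ s, cosetSum H (F i) := by
  have := Fintype.ofFinite (G ⧸ H)
  simp only [cosetSum, finsum_eq_sum_of_fintype]
  exact Finset.sum_comm

theorem map_cosetSum {H : Subgroup G} {Φ : Type*} [FunLike Φ A B] [AddMonoidHomClass Φ A B]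
    (f : Φ) (F : G → A) : f (cosetSum H F) = cosetSum H (fun x => f (F x)) := by
  have := Fintype.ofFinite (G ⧸ H)
  simp only [cosetSum, finsum_eq_sum_of_fintype, map_sum]

theorem cosetSum_const (H : Subgroup G) (a : A) :
    cosetSum H (fun _ => a) = H.index • a := by
  have := Fintype.ofFinite (G ⧸ H)
  simp only [cosetSum, finsum_eq_sum_of_fintype, Finset.sum_const, Finset.card_univ]
  rw [Subgroup.index, Nat.card_eq_fintype_card]

theorem cosetSum_trans {K S : Subgroup G} (hKS : K ≤ S) {F : G → A}
    (hF : ∀ g, ∀ h ∈ K, F (g * h) = F g) :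
    cosetSum K F = cosetSum S (fun x => cosetSum (K.subgroupOf S) (fun z : S => F (x * z))) := by
  have := Fintype.ofFinite (G ⧸ K)
  have := Fintype.ofFinite (G ⧸ S)
  have := Fintype.ofFinite (S ⧸ K.subgroupOf S)
  simp only [cosetSum, finsum_eq_sum_of_fintype]
  rw [← Fintype.sum_prod_type', ← (Subgroup.quotientEquivProdOfLE hKS).symm.sum_comp]
  refine Finset.sum_congr rfl fun p _ => ?_
  rw [← apply_out_mk hF (p.1.out * (p.2.out : S))]
  congr 2
  conv_lhs => rw [← Prod.mk.eta (p := p), ← QuotientGroup.out_eq' p.2]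
  rfl

end CosetSum

/-! ### Relative traces of endomorphisms and induced modules. -/

namespace Representation

variable {k G V : Type*} [Field k] [Group G] [AddCommGroup V] [Module k V]
  (ρ : Representation k G V)

/-- The conjugate `g γ g⁻¹` of a linear endomorphism. -/
def conjEnd (g : G) (γ : V →ₗ[k] V) : V →ₗ[k] V := ρ g ∘ₗ γ ∘ₗ ρ g⁻¹

theorem conjEnd_apply (g : G) (γ : V →ₗ[k] V) (v : V) :
    ρ.conjEnd g γ v = ρ g (γ (ρ g⁻¹ v)) := rfl

theorem apply_inv_apply (g : G) (v : V) : ρ g (ρ g⁻¹ v) = v := by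
  rw [← Module.End.mul_apply, ← map_mul]; simp

theorem inv_apply_apply (g : G) (v : V) : ρ g⁻¹ (ρ g v) = v := by
  rw [← Module.End.mul_apply, ← map_mul]; simp

theorem mul_apply_apply (g h : G) (v : V) : ρ (g * h) v = ρ g (ρ h v) := by
  rw [map_mul]; rfl

theorem conjEnd_mul (g h : G) (γ : V →ₗ[k] V) :
    ρ.conjEnd (g * h) γ = ρ.conjEnd g (ρ.conjEnd h γ) := by
  ext v
  simp only [conjEnd_apply, mul_inv_rev, mul_apply_apply]

/-- The relative trace of a linear endomorphism. -/
noncomputable def traceEnd (H : Subgroup G) (γ : V →ₗ[k] V) : V →ₗ[k] V :=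
  cosetSum H (fun x => ρ.conjEnd x γ)

variable {ρ}

theorem conjEnd_mul_of_fixed {H : Subgroup G} {γ : V →ₗ[k] V}
    (hγ : ∀ h ∈ H, ρ.conjEnd h γ = γ) (g : G) (h : G) (hh : h ∈ H) :
    ρ.conjEnd (g * h) γ = ρ.conjEnd g γ := by
  rw [conjEnd_mul, hγ h hh]

theorem traceEnd_apply [Finite G] (H : Subgroup G) (γ : V →ₗ[k] V) (v : V) :
    ρ.traceEnd H γ v = cosetSum H (fun x => ρ x (γ (ρ x⁻¹ v))) :=
  map_cosetSum (LinearMap.applyₗ (R := k) v) _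

theorem traceEnd_comm [Finite G] {H : Subgroup G} {γ : V →ₗ[k] V}
    (hγ : ∀ h ∈ H, ρ.conjEnd h γ = γ) (g : G) :
    ρ.traceEnd H γ ∘ₗ ρ g = ρ g ∘ₗ ρ.traceEnd H γ := by
  ext v
  rw [LinearMap.comp_apply, LinearMap.comp_apply, traceEnd_apply, traceEnd_apply,
    map_cosetSum (ρ g)]
  rw [← cosetSum_mul_left (H := H) (F := fun x => ρ x (γ (ρ x⁻¹ (ρ g v)))) _ g]
  · congr 1
    funext x
    rw [← mul_apply_apply, mul_inv_rev, ← mul_apply_apply, inv_mul_cancel_right]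
  · intro x h hh
    exact LinearMap.congr_fun (conjEnd_mul_of_fixed hγ x h hh) (ρ g v)

end Representation

namespace Representation

section

variable {k G V : Type*} [Field k] [Group G] [AddCommGroup V] [Module k V]
  {ρ : Representation k G V}

theorem conjEnd_smul_id (c : k) (g : G) :
    ρ.conjEnd g (c • LinearMap.id) = c • LinearMap.id := by
  ext v
  rw [conjEnd_apply, LinearMap.smul_apply, LinearMap.id_apply, map_smul, apply_inv_apply]
  rfl

theorem traceEnd_smul_id [Finite G] (H : Subgroup G) (c : k) :
    ρ.traceEnd H (c • LinearMap.id) = ((H.index : k) * c) • LinearMap.id := by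
  unfold traceEnd
  simp only [conjEnd_smul_id]
  rw [cosetSum_const, ← Nat.cast_smul_eq_nsmul k, smul_smul]

/-- As `δ` commutes with `G` and the trace is invariant under conjugation, each of the `[G : H]`
summands contributes the same amount. This is the source of the bound on vertices. -/
theorem trace_comp_traceEnd [Finite G] [Module.Finite k V] (H : Subgroup G) (γ δ : V →ₗ[k] V)
    (hδ : ∀ g, δ ∘ₗ ρ g = ρ g ∘ₗ δ) :
    LinearMap.trace k V (δ ∘ₗ ρ.traceEnd H γ) = (H.index : k) * LinearMap.trace k V (δ ∘ₗ γ) := by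
  have h1 : LinearMap.trace k V (δ ∘ₗ ρ.traceEnd H γ) =
      cosetSum H (fun x => LinearMap.trace k V (δ ∘ₗ ρ.conjEnd x γ)) :=
    map_cosetSum (LinearMap.trace k V ∘ₗ LinearMap.llcomp k V V V δ) _
  have h2 : ∀ x, LinearMap.trace k V (δ ∘ₗ ρ.conjEnd x γ) = LinearMap.trace k V (δ ∘ₗ γ) := by
    intro x
    rw [conjEnd, ← LinearMap.comp_assoc, hδ, LinearMap.comp_assoc, LinearMap.trace_comp_comm',
      LinearMap.comp_assoc, LinearMap.comp_assoc]
    congr 2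
    ext v
    simp
  rw [h1]
  simp only [h2]
  rw [cosetSum_const, nsmul_eq_mul]

end

section Ind

variable {k G V : Type*} [Field k] [Group G] [AddCommGroup V] [Module k V]
  {H : Subgroup G} (σ : Representation k H V)

theorem IndV.mk_mul (h : H) (g : G) (a : V) :
    IndV.mk H.subtype σ (h * g) (σ h a) = IndV.mk H.subtype σ g a := by
  have := Coinvariants.mk_self_apply (Representation.tprod ((leftRegular k G).comp H.subtype) σ) h
    (TensorProduct.mk k _ _ (.single g 1) a)
  simpa using this

open Classical in
/-- The projection of `Ind_H^G V` onto `V`. -/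
noncomputable def indProj : IndV H.subtype σ →ₗ[k] IndV H.subtype σ :=
  Coinvariants.lift _
    (TensorProduct.lift <| (Finsupp.lift _ _ _ fun g : G =>
        if g ∈ H then IndV.mk H.subtype σ g else 0) ∘ₗ
      (MonoidAlgebra.coeffLinearEquiv k).toLinearMap)
    fun h => by
      ext g a
      have h1 : (h : G) * g ∈ H ↔ g ∈ H := H.mul_mem_cancel_left h.2
      by_cases hg : g ∈ H
      · have := IndV.mk_mul σ h g a
        simpa [h1, hg] using this
      · simp [h1, hg]

open Classical in
theorem indProj_mk (g : G) (a : V) :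
    indProj σ (IndV.mk H.subtype σ g a) = if g ∈ H then IndV.mk H.subtype σ g a else 0 := by
  by_cases hg : g ∈ H <;> simp [indProj, hg]

theorem conjEnd_indProj_mk (x g : G) (a : V) [Decidable (g * x ∈ H)] :
    (ind H.subtype σ).conjEnd x (indProj σ) (IndV.mk H.subtype σ g a) =
      if g * x ∈ H then IndV.mk H.subtype σ g a else 0 := by
  rw [conjEnd_apply, ind_mk, indProj_mk, inv_inv]
  by_cases h : g * x ∈ H
  · rw [if_pos h, if_pos h, ind_mk, mul_inv_cancel_right]
  · rw [if_neg h, if_neg h, map_zero]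

theorem conjEnd_indProj (h : G) (hh : h ∈ H) :
    (ind H.subtype σ).conjEnd h (indProj σ) = indProj σ := by
  classical
  refine IndV.hom_ext _ _ fun g => LinearMap.ext fun a => ?_
  change (ind H.subtype σ).conjEnd h (indProj σ) (IndV.mk H.subtype σ g a) =
    indProj σ (IndV.mk H.subtype σ g a)
  rw [conjEnd_indProj_mk, indProj_mk,
    H.mul_mem_cancel_right hh]

/-- The conjugates of `indProj` over `G/H` are the projections onto the translates of `V`, which
together decompose the induced module. On `IndV.mk _ _ g a` only the coset of `g⁻¹` contributes. -/
theorem traceEnd_indProj [Finite G] :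
    (ind H.subtype σ).traceEnd H (indProj σ) = LinearMap.id := by
  classical
  have := Fintype.ofFinite (G ⧸ H)
  refine IndV.hom_ext _ _ fun g => LinearMap.ext fun a => ?_
  change (ind H.subtype σ).traceEnd H (indProj σ) (IndV.mk H.subtype σ g a) =
    IndV.mk H.subtype σ g a
  have h1 : (ind H.subtype σ).traceEnd H (indProj σ) (IndV.mk H.subtype σ g a) =
      cosetSum H (fun x => if g * x ∈ H then IndV.mk H.subtype σ g a else 0) := by
    simp only [← conjEnd_indProj_mk]
    exact map_cosetSum (LinearMap.applyₗ (R := k) (IndV.mk H.subtype σ g a)) _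
  rw [h1, cosetSum, finsum_eq_single _ (QuotientGroup.mk g⁻¹ : G ⧸ H)]
  · rw [if_pos]
    have h2 := QuotientGroup.eq.1 (QuotientGroup.out_eq' (QuotientGroup.mk g⁻¹ : G ⧸ H)).symm
    rwa [inv_inv] at h2
  · intro x hx
    rw [if_neg]
    intro h2
    refine hx ?_
    rw [← QuotientGroup.out_eq' x, QuotientGroup.eq]
    simpa using H.inv_mem h2

end Ind

end Representation

/-! ### Higman's criterion. -/

namespace Rep

open Representation

variable {k : Type u} {G : Type u} [Field k] [Group G] [Finite G]

omit [Finite G] in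
theorem apply_comm {M N : Rep.{u} k G} (f : M ⟶ N) (g : G) :
    f.hom.toLinearMap ∘ₗ M.ρ g = N.ρ g ∘ₗ f.hom.toLinearMap := f.hom.isIntertwining' g

omit [Finite G] in
theorem conjEnd_comp_comp {M N : Rep.{u} k G} (i : M ⟶ N) (r : N ⟶ M) (γ : N.V →ₗ[k] N.V) (g : G) :
    M.ρ.conjEnd g (r.hom.toLinearMap ∘ₗ γ ∘ₗ i.hom.toLinearMap) =
      r.hom.toLinearMap ∘ₗ N.ρ.conjEnd g γ ∘ₗ i.hom.toLinearMap := by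
  ext v
  have h1 := Rep.hom_comm_apply i g⁻¹ v
  have h2 := Rep.hom_comm_apply r g (γ (i.hom (M.ρ g⁻¹ v)))
  rw [h1] at h2
  change M.ρ g (r.hom (γ (i.hom (M.ρ g⁻¹ v)))) = r.hom (N.ρ g (γ (N.ρ g⁻¹ (i.hom v))))
  rw [h1, h2]

/-- The homomorphism of `kG`-modules given by the relative trace of an `H`-endomorphism. -/
noncomputable def traceHom (U : Rep.{u} k G) {H : Subgroup G} (γ : U.V →ₗ[k] U.V)
    (hγ : ∀ h ∈ H, U.ρ.conjEnd h γ = γ) : U ⟶ U :=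
  Rep.ofHom ⟨U.ρ.traceEnd H γ, traceEnd_comm hγ⟩

theorem traceHom_toLinearMap (U : Rep.{u} k G) {H : Subgroup G} (γ : U.V →ₗ[k] U.V)
    (hγ : ∀ h ∈ H, U.ρ.conjEnd h γ = γ) :
    (traceHom U γ hγ).hom.toLinearMap = U.ρ.traceEnd H γ := rfl

/-- Higman's criterion: a relatively `H`-projective module has an `H`-endomorphism of trace `1`. -/
theorem exists_traceEnd_eq_id {H : Subgroup G} {U : Rep.{u} k G} (h : IsRelProjective H U) :
    ∃ γ : U.V →ₗ[k] U.V, (∀ h ∈ H, U.ρ.conjEnd h γ = γ) ∧ U.ρ.traceEnd H γ = LinearMap.id := by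
  obtain ⟨N, _, ⟨R⟩⟩ := h
  refine ⟨R.r.hom.toLinearMap ∘ₗ indProj N.ρ ∘ₗ R.i.hom.toLinearMap, ?_, ?_⟩
  · intro h hh
    exact (conjEnd_comp_comp R.i R.r _ h).trans (congrArg
      (fun t => R.r.hom.toLinearMap ∘ₗ t ∘ₗ R.i.hom.toLinearMap) (conjEnd_indProj N.ρ h hh))
  · ext v
    have h0 : U.ρ.traceEnd H (R.r.hom.toLinearMap ∘ₗ indProj N.ρ ∘ₗ R.i.hom.toLinearMap) =
        cosetSum H (fun x => R.r.hom.toLinearMap ∘ₗ (Rep.ind H.subtype N).ρ.conjEnd x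
        (indProj N.ρ) ∘ₗ R.i.hom.toLinearMap) :=
      congrArg (cosetSum H) (funext fun x => conjEnd_comp_comp R.i R.r _ x)
    have h1 : cosetSum H (fun x => R.r.hom.toLinearMap ∘ₗ (Rep.ind H.subtype N).ρ.conjEnd x
        (indProj N.ρ) ∘ₗ R.i.hom.toLinearMap) v = R.r.hom.toLinearMap
          ((Rep.ind H.subtype N).ρ.traceEnd H (indProj N.ρ) (R.i.hom.toLinearMap v)) := by
      rw [traceEnd]
      have := map_cosetSum (H := H) (LinearMap.applyₗ (R := k) v)
        (fun x => R.r.hom.toLinearMap ∘ₗ (Rep.ind H.subtype N).ρ.conjEnd x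
        (indProj N.ρ) ∘ₗ R.i.hom.toLinearMap)
      refine this.trans ?_
      exact (map_cosetSum (H := H) (R.r.hom.toLinearMap ∘ₗ LinearMap.applyₗ (R := k)
        (R.i.hom.toLinearMap v)) (fun x => (Rep.ind H.subtype N).ρ.conjEnd x (indProj N.ρ))).symm
    rw [h0, h1]
    have h2 := LinearMap.congr_fun (traceEnd_indProj N.ρ) (R.i.hom.toLinearMap v)
    exact (congrArg R.r.hom h2).trans (congrArg (fun f : U ⟶ U => f.hom v) R.retract)

/-- Higman's criterion: if the trace of some `H`-endomorphism is invertible, then the module is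
relatively `H`-projective. -/
theorem isRelProjective_of_isIso {H : Subgroup G} {U : Rep.{u} k G} [Module.Finite k U.V]
    (γ : U.V →ₗ[k] U.V) (hγ : ∀ h ∈ H, U.ρ.conjEnd h γ = γ) (h : IsIso (traceHom U γ hγ)) :
    IsRelProjective H U := by
  let N : Rep.{u} k H := Rep.res H.subtype U
  -- `IndV.mk _ _ x⁻¹ a` plays the role of `x ⊗ a`, so this is the standard section `v ↦ ∑ x ⊗ γ
  -- (x⁻¹ v)`. Following it with `x ⊗ a ↦ x a` gives the relative trace of `γ`.
  let F : U.V → G → IndV H.subtype N.ρ := fun v x => IndV.mk H.subtype N.ρ x⁻¹ (γ (U.ρ x⁻¹ v))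
  have hF : ∀ v g, ∀ h ∈ H, F v (g * h) = F v g := by
    intro v g h hh
    have h1 := IndV.mk_mul N.ρ ⟨h⁻¹, H.inv_mem hh⟩ g⁻¹ (γ (U.ρ g⁻¹ v))
    have h2 : U.ρ h⁻¹ (γ (U.ρ g⁻¹ v)) = γ (U.ρ (h⁻¹ * g⁻¹) v) := by
      have := LinearMap.congr_fun (hγ _ (H.inv_mem hh)) (U.ρ h⁻¹ (U.ρ g⁻¹ v))
      rw [conjEnd_apply, inv_inv, apply_inv_apply] at this
      rw [this, mul_apply_apply]
    change IndV.mk H.subtype N.ρ (g * h)⁻¹ (γ (U.ρ (g * h)⁻¹ v)) = _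
    rw [mul_inv_rev, ← h2]
    exact h1
  let s : U.V →ₗ[k] IndV H.subtype N.ρ :=
    cosetSum H (fun x => IndV.mk H.subtype N.ρ x⁻¹ ∘ₗ γ ∘ₗ U.ρ x⁻¹)
  have hs : ∀ v, s v = cosetSum H (F v) := fun v =>
    map_cosetSum (LinearMap.applyₗ (R := k) v) _
  let S : U ⟶ Rep.ind H.subtype N := Rep.ofHom ⟨s, fun g => by
    ext v
    rw [LinearMap.comp_apply, LinearMap.comp_apply, hs, hs, ← cosetSum_mul_left (hF _) g,
      map_cosetSum]
    congr 1
    funext x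
    change IndV.mk H.subtype N.ρ (g * x)⁻¹ (γ (U.ρ (g * x)⁻¹ (U.ρ g v))) =
      Representation.ind H.subtype N.ρ g (IndV.mk H.subtype N.ρ x⁻¹ (γ (U.ρ x⁻¹ v)))
    rw [ind_mk, mul_inv_rev, ← mul_apply_apply, inv_mul_cancel_right]⟩
  let R : Rep.ind H.subtype N ⟶ U := (Rep.indResHomEquiv H.subtype N U).symm (𝟙 N)
  have hR : ∀ g a, R.hom (IndV.mk H.subtype N.ρ g a) = U.ρ g⁻¹ a := by
    intro g a
    simp [R]
  have hSR : S ≫ R = traceHom U γ hγ := by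
    refine Rep.hom_ext (IntertwiningMap.ext (LinearMap.ext fun v => ?_))
    rw [traceHom_toLinearMap, traceEnd_apply]
    change R.hom (s v) = _
    rw [hs, map_cosetSum R.hom]
    congr 1
    funext x
    rw [hR, inv_inv]
  refine ⟨N, ‹Module.Finite k U.V›, ⟨⟨S, R ≫ inv (traceHom U γ hγ), ?_⟩⟩⟩
  rw [← Category.assoc, hSR, IsIso.hom_inv_id]

end Rep

/-! ### Sylow subgroups and vertices. -/

namespace Rep

open Representation

variable {k : Type u} {G : Type u} [Field k] [Group G] [Finite G] (p : ℕ) [Fact p.Prime] [CharP k p]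

theorem sylow_index_ne_zero (S : Sylow p G) : ((S : Subgroup G).index : k) ≠ 0 := by
  rw [Ne, CharP.cast_eq_zero_iff k p]
  exact S.not_dvd_index

/-- The index of `S` is invertible in `k`, and the scalar `[G : S]⁻¹` has relative trace the
identity. -/
theorem isRelProjective_sylow (S : Sylow p G) (U : Rep.{u} k G) [Module.Finite k U.V] :
    IsRelProjective (S : Subgroup G) U := by
  refine isRelProjective_of_isIso (((S : Subgroup G).index : k)⁻¹ • LinearMap.id)
    (fun h _ => conjEnd_smul_id _ h) ?_
  have : traceHom (H := (S : Subgroup G)) U (((S : Subgroup G).index : k)⁻¹ • LinearMap.id)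
    (fun h _ => conjEnd_smul_id _ h) = 𝟙 U := by
    refine Rep.hom_ext (IntertwiningMap.ext ?_)
    rw [traceHom_toLinearMap, traceEnd_smul_id, mul_inv_cancel₀ (sylow_index_ne_zero p S), one_smul]
    rfl
  rw [this]
  infer_instance

variable {p}

omit [Fact p.Prime] in
theorem not_dvd_index_of_isRelProjective {U : Rep.{u} k G} [Module.Finite k U.V] (δ : U ⟶ U)
    (hδ : LinearMap.trace k U.V δ.hom.toLinearMap ≠ 0) {H : Subgroup G}
    (hH : IsRelProjective H U) : ¬ p ∣ H.index := by
  obtain ⟨γ, -, hγ⟩ := exists_traceEnd_eq_id hH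
  have h := trace_comp_traceEnd H γ δ.hom.toLinearMap (apply_comm δ)
  rw [hγ, LinearMap.comp_id] at h
  intro hp
  rw [(CharP.cast_eq_zero_iff k p _).2 hp, zero_mul] at h
  exact hδ h

/-- The vertices of a module which has an endomorphism of nonzero trace are the Sylow subgroups. -/
theorem isVertex_iff_of_trace_ne_zero {U : Rep.{u} k G} [Module.Finite k U.V] (δ : U ⟶ U)
    (hδ : LinearMap.trace k U.V δ.hom.toLinearMap ≠ 0) (P : Subgroup G) :
    IsVertex P U ↔ ∃ S : Sylow p G, (S : Subgroup G) = P := by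
  constructor
  · intro hP
    obtain ⟨T⟩ : Nonempty (Sylow p P) := inferInstance
    -- A Sylow subgroup of `P` has index prime to `p` in `G`, so it is Sylow in `G`. The module is
    -- projective relative to it, and minimality of `P` gives equality.
    have hT : IsPGroup p ((T : Subgroup P).map P.subtype) := T.isPGroup'.map _
    have hidx : ¬ p ∣ ((T : Subgroup P).map P.subtype).index := by
      rw [Subgroup.index_map_subtype, (Fact.out : p.Prime).dvd_mul, not_or]
      exact ⟨T.not_dvd_index, not_dvd_index_of_isRelProjective δ hδ hP.1⟩
    refine ⟨hT.toSylow hidx, ?_⟩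
    have hle : (T : Subgroup P).map P.subtype ≤ P := Subgroup.map_subtype_le _
    exact le_antisymm hle (hP.2 (isRelProjective_sylow p (hT.toSylow hidx) U) hle)
  · rintro ⟨S, rfl⟩
    refine ⟨isRelProjective_sylow p S U, fun H hH hle => ?_⟩
    have hidx := not_dvd_index_of_isRelProjective (p := p) δ hδ hH
    have hHp : IsPGroup p H := S.isPGroup'.to_le hle
    exact le_of_eq ((hHp.toSylow hidx).is_maximal' S.isPGroup' hle)

end Rep

/-! ### Permutation bases and `p`-groups. -/

theorem sum_eq_sum_cosetSum_stabilizer {S ι A : Type*} [Group S] [MulAction S ι] [Fintype ι]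
    [AddCommMonoid A] [Fintype (MulAction.orbitRel.Quotient S ι)] [Finite S] (F : ι → A) :
    ∑ i, F i = ∑ ω : MulAction.orbitRel.Quotient S ι,
      cosetSum (MulAction.stabilizer S ω.out) (fun s => F (s • ω.out)) := by
  classical
  have := fun ω : MulAction.orbitRel.Quotient S ι =>
    Fintype.ofFinite (S ⧸ MulAction.stabilizer S ω.out)
  simp only [cosetSum, finsum_eq_sum_of_fintype]
  rw [← Fintype.sum_sigma', ← (MulAction.selfEquivSigmaOrbitsQuotientStabilizer S ι).symm.sum_comp]
  refine Finset.sum_congr rfl fun p _ => ?_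
  obtain ⟨ω, z⟩ := p
  congr 1
  conv_lhs => rw [← QuotientGroup.out_eq' z]
  rfl

namespace Representation

variable {k G V : Type*} [Field k] [Group G] [AddCommGroup V] [Module k V]
  (ρ : Representation k G V)

/-- Conjugation by `g` as an additive map. -/
def conjEndHom (g : G) : (V →ₗ[k] V) →+ (V →ₗ[k] V) where
  toFun := ρ.conjEnd g
  map_zero' := by ext v; simp [conjEnd_apply]
  map_add' γ δ := by ext v; simp [conjEnd_apply]

/-- A nonzero representation of a `p`-group in characteristic `p` has nonzero fixed vectors. -/
theorem exists_fixed_of_isPGroup [Finite G] {p : ℕ} [Fact p.Prime] [CharP k p] (hG : IsPGroup p G)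
    (K : Submodule k V) (hK : ∀ g, ∀ v ∈ K, ρ g v ∈ K) (hK0 : K ≠ ⊥) :
    ∃ v ∈ K, v ≠ 0 ∧ ∀ g, ρ g v = v := by
  obtain ⟨v, hvK, hv0⟩ := K.exists_mem_ne_zero_of_ne_bot hK0
  have hpV : ∀ w : V, (p : ℤ) • w = 0 := by
    intro w
    rw [← Int.cast_smul_eq_zsmul k, Int.cast_natCast, CharP.cast_eq_zero, zero_smul]
  -- `k` may be infinite, so fixed points are counted in the additive group spanned by one orbit. It
  -- is finitely generated and killed by `p`, hence finite of order divisible by `p`.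
  let A : Submodule ℤ V := Submodule.span ℤ (Set.range fun g => ρ g v)
  have hAK : ∀ a ∈ A, a ∈ K := by
    intro a ha
    have : A ≤ K.restrictScalars ℤ := Submodule.span_le.2 (by rintro _ ⟨g, rfl⟩; exact hK g v hvK)
    exact this ha
  have hAst : ∀ g, ∀ a ∈ A, ρ g a ∈ A := by
    intro g
    have : A ≤ A.comap ((ρ g).restrictScalars ℤ) := by
      refine Submodule.span_le.2 ?_
      rintro _ ⟨h, rfl⟩
      refine Submodule.subset_span ⟨g * h, ?_⟩
      simp
    exact fun a ha => this ha
  have hvA : v ∈ A := Submodule.subset_span ⟨1, by simp⟩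
  have : Module.Finite ℤ A := Module.Finite.span_of_finite ℤ (Set.finite_range _)
  have hfin : Finite A := by
    refine Module.finite_of_fg_torsion A ?_
    intro a
    refine ⟨⟨(p : ℤ), ?_⟩, ?_⟩
    · exact mem_nonZeroDivisors_of_ne_zero (by exact_mod_cast (Fact.out : p.Prime).ne_zero)
    · exact Subtype.ext (hpV a)
  let act : MulAction G A :=
    { smul := fun g a => ⟨ρ g a, hAst g a a.2⟩
      one_smul := fun a => Subtype.ext (by change ρ 1 (a : V) = a; simp)
      mul_smul := fun g h a => Subtype.ext (by
        change ρ (g * h) (a : V) = ρ g (ρ h a); simp) }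
  have hcard : p ∣ Nat.card A := by
    have h1 : addOrderOf (⟨v, hvA⟩ : A) = p := by
      refine addOrderOf_eq_prime ?_ ?_
      · refine Subtype.ext ?_
        have := hpV v
        rw [natCast_zsmul] at this
        exact this
      · intro h
        exact hv0 (congrArg Subtype.val h)
    rw [← h1]
    exact addOrderOf_dvd_natCard _
  have h0 : (0 : A) ∈ MulAction.fixedPoints G A := fun g => Subtype.ext (map_zero (ρ g))
  obtain ⟨b, hb, hb0⟩ := hG.exists_fixed_point_of_prime_dvd_card_of_fixed_point A hcard h0
  refine ⟨b, hAK _ b.2, ?_, fun g => congrArg Subtype.val (hb g)⟩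
  intro h
  exact hb0 (Subtype.ext h.symm)

section PermBasis

variable {ρ} {ι : Type*} (b : Module.Basis ι k V)

/-- The projection onto the line spanned by a basis vector. -/
noncomputable def basisProj (i : ι) : V →ₗ[k] V := (b.coord i).smulRight (b i)

theorem basisProj_apply (i : ι) (v : V) : basisProj b i v = b.repr v i • b i := rfl

theorem sum_basisProj [Fintype ι] : ∑ i, basisProj b i = LinearMap.id := by
  ext v
  rw [LinearMap.sum_apply]
  exact b.sum_repr v

variable [MulAction G ι] (hb : ∀ g i, ρ g (b i) = b (g • i))
include hb

theorem repr_smul (g : G) (v : V) (i : ι) : b.repr (ρ g v) (g • i) = b.repr v i := by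
  classical
  have : (b.coord (g • i)) ∘ₗ ρ g = b.coord i := by
    refine b.ext fun j => ?_
    rw [LinearMap.comp_apply, hb, b.coord_apply, b.coord_apply, b.repr_self, b.repr_self,
      Finsupp.single_apply, Finsupp.single_apply]
    simp
  exact LinearMap.congr_fun this v

theorem conjEnd_basisProj (g : G) (i : ι) : ρ.conjEnd g (basisProj b i) = basisProj b (g • i) := by
  ext v
  rw [conjEnd_apply, basisProj_apply, basisProj_apply, map_smul, hb, ← repr_smul b hb g,
    apply_inv_apply]

theorem conjEnd_basisProj_stabilizer (i : ι) :
    ∀ g ∈ MulAction.stabilizer G i, ρ.conjEnd g (basisProj b i) = basisProj b i := by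
  intro g hg
  rw [conjEnd_basisProj b hb, MulAction.mem_stabilizer_iff.1 hg]

/-- Each orbit contributes the projection onto its span, written as a relative trace from a point
stabilizer. -/
theorem sum_traceEnd_basisProj [Finite G] [Finite ι]
    [Fintype (MulAction.orbitRel.Quotient G ι)] :
    ∑ ω : MulAction.orbitRel.Quotient G ι,
      ρ.traceEnd (MulAction.stabilizer G ω.out) (basisProj b ω.out) = LinearMap.id := by
  have := Fintype.ofFinite ι
  rw [← sum_basisProj b, sum_eq_sum_cosetSum_stabilizer (S := G) (basisProj b)]
  refine Finset.sum_congr rfl fun ω _ => ?_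
  simp only [traceEnd, conjEnd_basisProj b hb]

end PermBasis

end Representation

namespace Rep

open Representation

variable {k : Type u} {G : Type u} [Field k] [Group G]

/-- The representation has a basis permuted by the group. -/
def HasPermBasis (M : Rep.{u} k G) : Prop :=
  ∃ B : Set M.V, LinearIndepOn k id B ∧ Submodule.span k B = ⊤ ∧ ∀ g, ∀ b ∈ B, M.ρ g b ∈ B

theorem hasPermBasis_of_basis {M : Rep.{u} k G} {ι : Type*} (b : Module.Basis ι k M.V)
    (hb : ∀ g i, ∃ j, M.ρ g (b i) = b j) : HasPermBasis M := by
  refine ⟨Set.range b, b.linearIndependent.linearIndepOn_id, b.span_eq, ?_⟩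
  rintro g _ ⟨i, rfl⟩
  obtain ⟨j, hj⟩ := hb g i
  exact ⟨j, hj.symm⟩

theorem HasPermBasis.exists_basis {M : Rep.{u} k G} (h : HasPermBasis M) :
    ∃ (ι : Type u) (_ : MulAction G ι) (b : Module.Basis ι k M.V),
      ∀ g i, M.ρ g (b i) = b (g • i) := by
  obtain ⟨B, hB, hspan, hperm⟩ := h
  let act : MulAction G B :=
    { smul := fun g x => ⟨M.ρ g x, hperm g x x.2⟩
      one_smul := fun x => Subtype.ext (by change M.ρ 1 (x : M.V) = x; simp)
      mul_smul := fun g h x => Subtype.ext (by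
        change M.ρ (g * h) (x : M.V) = M.ρ g (M.ρ h x); simp) }
  have hB' : LinearIndependent k (fun x : B => (x : M.V)) := hB
  refine ⟨B, act, Module.Basis.mk hB' (by simp [hspan]), fun g i => ?_⟩
  rw [Module.Basis.mk_apply, Module.Basis.mk_apply]
  rfl

theorem HasPermBasis.of_sum {X Y Z : Rep.{u} k G} (i : Y ⟶ X) (q : X ⟶ Y) (j : Z ⟶ X)
    (r : X ⟶ Z) (hiq : i ≫ q = 𝟙 Y) (hjr : j ≫ r = 𝟙 Z) (hir : i ≫ r = 0) (hjq : j ≫ q = 0)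
    (h : q ≫ i + r ≫ j = 𝟙 X)
    (hY : HasPermBasis Y) (hZ : HasPermBasis Z) : HasPermBasis X := by
  obtain ⟨ι, _, b, hb⟩ := hY.exists_basis
  obtain ⟨κ, _, c, hc⟩ := hZ.exists_basis
  have e1 : ∀ y, q.hom (i.hom y) = y := fun y => congrArg (fun f : Y ⟶ Y => f.hom y) hiq
  have e2 : ∀ y, r.hom (j.hom y) = y := fun y => congrArg (fun f : Z ⟶ Z => f.hom y) hjr
  have e3 : ∀ y, r.hom (i.hom y) = 0 := fun y => congrArg (fun f : Y ⟶ Z => f.hom y) hir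
  have e4 : ∀ y, q.hom (j.hom y) = 0 := fun y => congrArg (fun f : Z ⟶ Y => f.hom y) hjq
  have e5 : ∀ x, i.hom (q.hom x) + j.hom (r.hom x) = x :=
    fun x => congrArg (fun f : X ⟶ X => f.hom x) h
  let e : (Y.V × Z.V) ≃ₗ[k] X.V := LinearEquiv.ofLinearMap
    (i.hom.toLinearMap.coprod j.hom.toLinearMap) (q.hom.toLinearMap.prod r.hom.toLinearMap)
    (LinearMap.ext fun x => e5 x)
    (LinearMap.ext fun x => Prod.ext
      ((map_add q.hom (i.hom x.1) (j.hom x.2)).trans (by rw [e1, e4, add_zero]; rfl))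
      ((map_add r.hom (i.hom x.1) (j.hom x.2)).trans (by rw [e2, e3, zero_add]; rfl)))
  have he : ∀ x, e x = i.hom x.1 + j.hom x.2 := fun x => rfl
  refine hasPermBasis_of_basis ((b.prod c).map e) ?_
  rintro g (s | s)
  · refine ⟨Sum.inl (g • s), ?_⟩
    simp only [Module.Basis.map_apply, Module.Basis.prod_apply_inl_fst,
      Module.Basis.prod_apply_inl_snd, he, map_zero, add_zero]
    rw [← hb, Rep.hom_comm_apply]
  · refine ⟨Sum.inr (g • s), ?_⟩
    simp only [Module.Basis.map_apply, Module.Basis.prod_apply_inr_fst,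
      Module.Basis.prod_apply_inr_snd, he, map_zero, zero_add]
    rw [← hc, Rep.hom_comm_apply]

end Rep

/-! ### Direct summands of permutation modules. -/

namespace Rep

open Representation

variable {k : Type u} {G : Type u} [Field k] [Group G]

theorem sum_toLinearMap {M N : Rep.{u} k G} {ι : Type*} (s : Finset ι) (f : ι → (M ⟶ N)) :
    (∑ i ∈ s, f i).hom.toLinearMap = ∑ i ∈ s, (f i).hom.toLinearMap :=
  map_sum (G := (M ⟶ N) →+ (M.V →ₗ[k] N.V)) ⟨⟨fun f => f.hom.toLinearMap, rfl⟩, fun _ _ => rfl⟩ f s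

theorem eq_of_toLinearMap {M N : Rep.{u} k G} {f g : M ⟶ N}
    (h : f.hom.toLinearMap = g.hom.toLinearMap) : f = g :=
  Rep.hom_ext (IntertwiningMap.ext h)

theorem bijective_of_isIso {M N : Rep.{u} k G} (f : M ⟶ N) [IsIso f] :
    Function.Bijective f.hom := by
  have : IsIso ((forget (Rep.{u} k G)).map f) := inferInstance
  exact (isIso_iff_bijective _).1 this

section

variable [Finite G] {p : ℕ} [Fact p.Prime] [CharP k p]

/-- `U` turns out to be isomorphic to the span `X` of a single orbit. The identity of `U` is a sum
over orbits, so locality selects one orbit through which `U` factors, and `R.r` maps `X` onto `U`.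
Injectivity on `X` holds because the fixed space of `X` is a line. -/
theorem HasPermBasis.of_indecomposable_retract (hG : IsPGroup p G) {U W : Rep.{u} k G}
    [Module.Finite k W.V] (hW : HasPermBasis W) (hU : Indecomposable U) (R : Retract U W) :
    HasPermBasis U := by
  classical
  have hfU : Module.Finite k U.V := finite_of_retract R
  obtain ⟨ι, _, b, hb⟩ := hW.exists_basis
  have : Finite ι := Module.Finite.finite_basis b
  have := Fintype.ofFinite (MulAction.orbitRel.Quotient G ι)
  let E : MulAction.orbitRel.Quotient G ι → (W ⟶ W) := fun ω =>
    traceHom W (basisProj b ω.out) (conjEnd_basisProj_stabilizer b hb ω.out)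
  have hE : ∑ ω, E ω = 𝟙 W := by
    refine eq_of_toLinearMap ?_
    rw [sum_toLinearMap]
    exact sum_traceEnd_basisProj b hb
  have hsum : ∑ ω, R.i ≫ E ω ≫ R.r = 𝟙 U := by
    rw [← Preadditive.comp_sum, ← Preadditive.sum_comp, hE, Category.id_comp, R.retract]
  obtain ⟨ω, -, hω⟩ := exists_isIso_of_sum hU Finset.univ (fun ω => R.i ≫ E ω ≫ R.r)
    (by rw [hsum]; infer_instance)
  let O : Set ι := MulAction.orbit G ω.out
  have hbij := bijective_of_isIso (R.i ≫ E ω ≫ R.r)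
  have hcomp : ∀ u, (R.i ≫ E ω ≫ R.r).hom u = R.r.hom ((E ω).hom (R.i.hom u)) := fun u => rfl
  let X : Submodule k W.V := Submodule.span k (b '' O)
  have hX : ∀ w, w ∈ X ↔ ∀ j ∉ O, b.repr w j = 0 := by
    intro w
    rw [Module.Basis.mem_span_image]
    constructor
    · intro h j hj
      by_contra h0
      exact hj (h (Finsupp.mem_support_iff.2 h0))
    · intro h j hj
      by_contra h0
      exact Finsupp.mem_support_iff.1 hj (h j h0)
  have hEX : ∀ w, (E ω).hom w ∈ X := by
    intro w
    rw [hX]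
    intro j hj
    have h1 : (E ω).hom w = cosetSum (MulAction.stabilizer G ω.out)
        (fun x => W.ρ x (basisProj b ω.out (W.ρ x⁻¹ w))) := traceEnd_apply _ _ w
    have h2 : b.coord j ((E ω).hom w) = 0 := by
      rw [h1, map_cosetSum]
      refine (finsum_congr fun x => ?_).trans finsum_zero
      change b.coord j (W.ρ x.out (basisProj b ω.out (W.ρ x.out⁻¹ w))) = 0
      rw [basisProj_apply, map_smul, hb, map_smul, b.coord_apply, b.repr_self,
        Finsupp.single_apply, if_neg, smul_zero]
      rintro rfl
      exact hj ⟨_, rfl⟩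
    exact h2
  have hXst : ∀ g, ∀ w ∈ X, W.ρ g w ∈ X := by
    intro g w hw
    rw [hX] at hw ⊢
    intro j hj
    have := repr_smul b hb g w (g⁻¹ • j)
    rw [smul_inv_smul] at this
    rw [this]
    refine hw _ fun h => hj ?_
    have := MulAction.mem_orbit_of_mem_orbit g h
    rwa [smul_inv_smul] at this
  have hfix : ∀ w ∈ X, (∀ g, W.ρ g w = w) → ∀ j ∈ O, b.repr w j = b.repr w ω.out := by
    rintro w - hw _ ⟨g, rfl⟩
    have := repr_smul b hb g w ω.out
    rwa [hw g] at this
  -- A nonzero kernel of `R.r` on `X` would contain a nonzero fixed vector, hence all fixed vectors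
  -- of `X`. But a nonzero fixed vector of `U` is carried to a fixed vector of `X` that `R.r` does
  -- not kill.
  have hdisj : Disjoint X (LinearMap.ker R.r.hom.toLinearMap) := by
    rw [disjoint_iff]
    by_contra hne
    obtain ⟨w₁, hw₁, hw₁0, hw₁f⟩ := exists_fixed_of_isPGroup W.ρ hG _ (by
      rintro g v ⟨h1, h2⟩
      refine ⟨hXst g v h1, ?_⟩
      have h3 : R.r.hom v = 0 := h2
      have : R.r.hom (W.ρ g v) = 0 := by rw [Rep.hom_comm_apply, h3, map_zero]
      exact this) hne
    have hUne : (⊤ : Submodule k U.V) ≠ ⊥ := by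
      intro h
      refine hU.1 ((isZero_iff_subsingleton U).2 ?_)
      exact (Submodule.subsingleton_iff k).1 (subsingleton_of_bot_eq_top h.symm)
    obtain ⟨v, -, hv0, hvf⟩ := exists_fixed_of_isPGroup U.ρ hG ⊤ (fun _ _ _ => Submodule.mem_top) hUne
    have hw₂f : ∀ g, W.ρ g ((E ω).hom (R.i.hom v)) = (E ω).hom (R.i.hom v) := by
      intro g
      rw [← Rep.hom_comm_apply, ← Rep.hom_comm_apply, hvf]
    have hc : b.repr w₁ ω.out ≠ 0 := by
      intro h
      apply hw₁0
      apply b.repr.injective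
      ext j
      by_cases hj : j ∈ O
      · rw [hfix w₁ hw₁.1 hw₁f j hj, h]; simp
      · rw [(hX _).1 hw₁.1 j hj]; simp
    have hw₂ : (E ω).hom (R.i.hom v) =
        (b.repr ((E ω).hom (R.i.hom v)) ω.out / b.repr w₁ ω.out) • w₁ := by
      apply b.repr.injective
      ext j
      rw [map_smul, Finsupp.smul_apply, smul_eq_mul]
      by_cases hj : j ∈ O
      · rw [hfix w₁ hw₁.1 hw₁f j hj, hfix _ (hEX _) hw₂f j hj, div_mul_cancel₀ _ hc]
      · rw [(hX _).1 hw₁.1 j hj, (hX _).1 (hEX _) j hj, mul_zero]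
    have h1 : R.r.hom w₁ = 0 := hw₁.2
    have h2 : (R.i ≫ E ω ≫ R.r).hom v = 0 := by
      rw [hcomp, hw₂, map_smul, h1, smul_zero]
    exact hv0 (hbij.1 (h2.trans (map_zero _).symm))
  have hli : LinearIndependent k (fun j : O => R.r.hom.toLinearMap (b j)) := by
    refine (b.linearIndependent.comp (Subtype.val : O → ι) Subtype.val_injective).map ?_
    rw [Set.range_comp, Subtype.range_coe]
    exact hdisj
  have hspan : ⊤ ≤ Submodule.span k (Set.range fun j : O => R.r.hom.toLinearMap (b j)) := by
    rintro u -
    obtain ⟨v, rfl⟩ := hbij.2 u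
    rw [hcomp]
    have h1 : Set.range (fun j : O => R.r.hom.toLinearMap (b j)) =
        R.r.hom.toLinearMap '' (b '' O) := by
      ext x
      simp
    rw [h1, ← Submodule.map_span]
    exact ⟨_, hEX _, rfl⟩
  refine hasPermBasis_of_basis (Module.Basis.mk hli hspan) fun g i => ?_
  refine ⟨⟨g • (i : ι), MulAction.mem_orbit_of_mem_orbit g i.2⟩, ?_⟩
  rw [Module.Basis.mk_apply, Module.Basis.mk_apply, ← hb]
  exact (Rep.hom_comm_apply R.r g (b i)).symm

omit [Finite G] in
theorem hasPermBasis_of_isZero {U : Rep.{u} k G} (h : IsZero U) : HasPermBasis U := by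
  have := (isZero_iff_subsingleton U).1 h
  exact ⟨∅, linearIndepOn_empty k id, Subsingleton.elim _ _, by simp⟩

omit [Finite G] in
/-- A nonzero finite-dimensional module is indecomposable or a sum of two smaller modules. -/
theorem indecomposable_or_exists_sum (U : Rep.{u} k G) [Module.Finite k U.V] (h0 : ¬ IsZero U) :
    Indecomposable U ∨ ∃ (Y Z : Rep.{u} k G) (i : Y ⟶ U) (q : U ⟶ Y) (j : Z ⟶ U) (r : U ⟶ Z),
      i ≫ q = 𝟙 Y ∧ j ≫ r = 𝟙 Z ∧ i ≫ r = 0 ∧ j ≫ q = 0 ∧ q ≫ i + r ≫ j = 𝟙 U ∧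
      Module.finrank k Y.V < Module.finrank k U.V ∧ Module.finrank k Z.V < Module.finrank k U.V := by
  by_cases hU : Indecomposable U
  · exact Or.inl hU
  right
  simp only [Indecomposable, not_and, not_forall, not_or] at hU
  obtain ⟨Y, Z, φ, hY, hZ⟩ := hU h0
  have lt : ∀ {A B : Rep.{u} k G} (i : A ⟶ U) (q : U ⟶ A) (j : B ⟶ U) (r : U ⟶ B),
      i ≫ q = 𝟙 A → j ≫ r = 𝟙 B → i ≫ r = 0 → ¬ IsZero B →
      Module.finrank k A.V < Module.finrank k U.V := by
    intro A B i q j r h1 h2 h3 hB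
    have hinj : Function.Injective i.hom.toLinearMap := retract_injective ⟨i, q, h1⟩
    have := LinearMap.finrank_range_of_inj hinj
    rw [← this]
    refine Submodule.finrank_lt fun htop => hB ((isZero_iff_subsingleton B).2 ⟨fun x y => ?_⟩)
    have : ∀ x : B.V, x = 0 := by
      intro x
      obtain ⟨a, ha⟩ : j.hom x ∈ LinearMap.range i.hom.toLinearMap := htop ▸ Submodule.mem_top
      have e1 : r.hom (j.hom x) = x := congrArg (fun f : B ⟶ B => f.hom x) h2
      have e2 : r.hom (i.hom a) = 0 := congrArg (fun f : A ⟶ B => f.hom a) h3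
      rw [← e1, ← ha]
      exact e2
    rw [this x, this y]
  have h1 : (biprod.inl ≫ φ.inv) ≫ φ.hom ≫ biprod.fst = 𝟙 Y := by simp
  have h2 : (biprod.inr ≫ φ.inv) ≫ φ.hom ≫ biprod.snd = 𝟙 Z := by simp
  have h3 : (biprod.inl ≫ φ.inv) ≫ φ.hom ≫ biprod.snd = (0 : Y ⟶ Z) := by simp
  have h4 : (biprod.inr ≫ φ.inv) ≫ φ.hom ≫ biprod.fst = (0 : Z ⟶ Y) := by simp
  refine ⟨Y, Z, _, _, _, _, h1, h2, h3, h4, ?_, lt _ _ _ _ h1 h2 h3 hZ, lt _ _ _ _ h2 h1 h4 hY⟩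
  have h5 : (φ.hom ≫ biprod.fst) ≫ biprod.inl ≫ φ.inv + (φ.hom ≫ biprod.snd) ≫ biprod.inr ≫ φ.inv =
      φ.hom ≫ (biprod.fst ≫ biprod.inl + biprod.snd ≫ biprod.inr) ≫ φ.inv := by
    simp only [Preadditive.add_comp, Preadditive.comp_add, Category.assoc]
  rw [h5, biprod.total, Category.id_comp, φ.hom_inv_id]

theorem HasPermBasis.of_retract (hG : IsPGroup p G) {U W : Rep.{u} k G}
    [Module.Finite k W.V] (hW : HasPermBasis W) (R : Retract U W) : HasPermBasis U := by
  induction hn : Module.finrank k U.V using Nat.strong_induction_on generalizing U with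
  | _ n ih =>
    subst hn
    have hfU : Module.Finite k U.V := finite_of_retract R
    by_cases h0 : IsZero U
    · exact hasPermBasis_of_isZero h0
    -- Induction on dimension: permutation bases of the two smaller summands combine to one of `U`.
    rcases indecomposable_or_exists_sum U h0 with h | ⟨Y, Z, i, q, j, r, h1, h2, h3, h4, h5, hY, hZ⟩
    · exact hW.of_indecomposable_retract hG h R
    · exact HasPermBasis.of_sum i q j r h1 h2 h3 h4 h5
        (ih _ hY (Retract.trans ⟨i, q, h1⟩ R) rfl) (ih _ hZ (Retract.trans ⟨j, r, h2⟩ R) rfl)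

end

theorem isPPermutation_iff (p : ℕ) (M : Rep.{u} k G) :
    IsPPermutation p M ↔ Module.Finite k M.V ∧
      ∀ P : Subgroup G, IsPGroup p P → HasPermBasis (Rep.res P.subtype M) := by
  constructor
  · rintro ⟨h1, h2⟩
    refine ⟨h1, fun P hP => ?_⟩
    obtain ⟨B, h3, h4, h5⟩ := h2 P hP
    exact ⟨B, h3, h4, fun g b hb => h5 g g.2 b hb⟩
  · rintro ⟨h1, h2⟩
    refine ⟨h1, fun P hP => ?_⟩
    obtain ⟨B, h3, h4, h5⟩ := h2 P hP
    exact ⟨B, h3, h4, fun g hg b hb => h5 ⟨g, hg⟩ b hb⟩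

theorem _root_.EndotrivialComplex.IsPPermutation.of_retract [Finite G] {p : ℕ} [Fact p.Prime]
    [CharP k p] {U W : Rep.{u} k G} (hW : IsPPermutation p W) (R : Retract U W) :
    IsPPermutation p U := by
  rw [isPPermutation_iff] at hW ⊢
  have := hW.1
  refine ⟨finite_of_retract R, fun P hP => ?_⟩
  have : Module.Finite k (Rep.res P.subtype W).V := hW.1
  exact (hW.2 P hP).of_retract hP (R.map (Rep.resFunctor P.subtype))

theorem isPPermutation_trivial (p : ℕ) : IsPPermutation p (Rep.trivial k G k) := by
  refine ⟨inferInstanceAs (Module.Finite k k), fun P _ => ⟨{(1 : k)}, ?_, ?_, ?_⟩⟩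
  · exact LinearIndepOn.singleton one_ne_zero
  · exact Ideal.span_singleton_one
  · rintro g - b hb
    exact hb

end Rep

/-! ### Indecomposable `p`-permutation modules as summands of `k[G/Q]`. -/

namespace Representation

variable {k G V : Type*} [Field k] [Group G] [AddCommGroup V] [Module k V]
  {ρ : Representation k G V} {S : Subgroup G} {ι : Type*} [MulAction S ι] (b : Module.Basis ι k V)
  (hb : ∀ (s : S) i, ρ s (b i) = b (s • i))

theorem conjEnd_smul (c : k) (g : G) (γ : V →ₗ[k] V) : ρ.conjEnd g (c • γ) = c • ρ.conjEnd g γ := by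
  ext v
  simp [conjEnd_apply]

include hb in
theorem conjEnd_basisProj_map_stabilizer (c : k) (i : ι) :
    ∀ g ∈ (MulAction.stabilizer S i).map S.subtype,
      ρ.conjEnd g (c • basisProj b i) = c • basisProj b i := by
  rintro _ ⟨s, hs, rfl⟩
  rw [conjEnd_smul]
  congr 1
  exact conjEnd_basisProj_stabilizer (ρ := ρ.comp S.subtype) b hb i s hs

include hb in
-- Transitivity of the trace: summed over the `S`-orbits, the traces up to `S` give `c` times the
-- identity, and the trace from `S` to `G` multiplies this by `[G : S]`.
theorem sum_traceEnd_map_stabilizer [Finite G] [Finite ι]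
    [Fintype (MulAction.orbitRel.Quotient S ι)] (c : k) :
    ∑ ω : MulAction.orbitRel.Quotient S ι,
      ρ.traceEnd ((MulAction.stabilizer S ω.out).map S.subtype) (c • basisProj b ω.out) =
      ((S.index : k) * c) • LinearMap.id := by
  have hle : ∀ K : Subgroup S, K.map S.subtype ≤ S := fun K => Subgroup.map_subtype_le K
  have heq : ∀ K : Subgroup S, (K.map S.subtype).subgroupOf S = K := fun K =>
    Subgroup.comap_map_eq_self_of_injective S.subtype_injective K
  have h1 : ∀ ω : MulAction.orbitRel.Quotient S ι,
      ρ.traceEnd ((MulAction.stabilizer S ω.out).map S.subtype) (c • basisProj b ω.out) =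
      cosetSum S (fun x => ρ.conjEnd x (c •
        traceEnd (ρ.comp S.subtype) (MulAction.stabilizer S ω.out) (basisProj b ω.out))) := by
    intro ω
    rw [traceEnd, cosetSum_trans (hle _)
      (conjEnd_mul_of_fixed (conjEnd_basisProj_map_stabilizer b hb c _)), heq]
    congr 1
    funext x
    simp only [conjEnd_mul]
    have := map_cosetSum (H := MulAction.stabilizer S ω.out) (ρ.conjEndHom x)
      (fun s : S => ρ.conjEnd s (c • basisProj b ω.out))
    refine this.symm.trans ?_
    change ρ.conjEnd x _ = _
    congr 1
    simp only [conjEnd_smul]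
    exact (map_cosetSum (H := MulAction.stabilizer S ω.out)
      (LinearMap.lsmul k (V →ₗ[k] V) c)
      (fun s : S => ρ.conjEnd s (basisProj b ω.out))).symm
  rw [Finset.sum_congr rfl fun ω _ => h1 ω, ← cosetSum_sum, ← traceEnd_smul_id]
  unfold traceEnd
  congr 1
  funext x
  have h2 := sum_traceEnd_basisProj (ρ := ρ.comp S.subtype) b hb
  rw [← h2, Finset.smul_sum]
  exact (map_sum (ρ.conjEndHom x) _ _).symm

end Representation

namespace Rep

open Representation

variable {k : Type u} {G : Type u} [Field k] [Group G] [Finite G] {p : ℕ} [Fact p.Prime] [CharP k p]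

/-- An indecomposable `p`-permutation module is a direct summand of `k[G/Q]` for some
`p`-subgroup `Q`. -/
theorem exists_isIso_traceHom {U : Rep.{u} k G} (hU : Indecomposable U) (hp : IsPPermutation p U) :
    ∃ (Q : Subgroup G) (γ : U.V →ₗ[k] U.V) (hγ : ∀ q ∈ Q, U.ρ.conjEnd q γ = γ),
      IsPGroup p Q ∧ (∀ q ∈ Q, ∀ v, U.ρ q (γ v) = γ v) ∧ IsIso (traceHom U γ hγ) := by
  rw [isPPermutation_iff] at hp
  obtain ⟨hfin, hp⟩ := hp
  obtain ⟨S⟩ : Nonempty (Sylow p G) := inferInstance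
  obtain ⟨ι, _, b, hb⟩ := (hp S S.isPGroup').exists_basis
  have : Module.Finite k (Rep.res (S : Subgroup G).subtype U).V := hfin
  have : Finite ι := Module.Finite.finite_basis b
  have := Fintype.ofFinite (MulAction.orbitRel.Quotient S ι)
  let b' : Module.Basis ι k U.V := b
  have hb' : ∀ (s : S) i, U.ρ s (b' i) = b' (s • i) := hb
  -- With this scalar the identity of `U` is a sum of traces from the stabilizers in `S` of basis
  -- vectors, and locality makes one of these traces invertible.
  let c : k := ((S : Subgroup G).index : k)⁻¹
  have hsum : ∑ ω : MulAction.orbitRel.Quotient S ι,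
      traceHom U (c • basisProj b' ω.out) (conjEnd_basisProj_map_stabilizer b' hb' c ω.out) = 𝟙 U := by
    refine eq_of_toLinearMap ?_
    rw [sum_toLinearMap]
    refine (sum_traceEnd_map_stabilizer b' hb' c).trans ?_
    rw [mul_inv_cancel₀ (sylow_index_ne_zero p S), one_smul]
    rfl
  obtain ⟨ω, -, hω⟩ := exists_isIso_of_sum hU Finset.univ _ (by rw [hsum]; infer_instance)
  refine ⟨_, _, _, ?_, ?_, hω⟩
  · exact S.isPGroup'.to_le (Subgroup.map_subtype_le _)
  · rintro _ ⟨s, hs, rfl⟩ v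
    have h1 : U.ρ s (b' ω.out) = b' ω.out := by
      rw [hb', MulAction.mem_stabilizer_iff.1 hs]
    change U.ρ s ((c • basisProj b' ω.out) v) = (c • basisProj b' ω.out) v
    rw [LinearMap.smul_apply, basisProj_apply, map_smul, map_smul, h1]

/-- An indecomposable `p`-permutation module is projective relative to a corefree `p`-subgroup, or
some nontrivial normal `p`-subgroup acts trivially on it. -/
theorem isRelProjective_or_acts_trivially {U : Rep.{u} k G} (hU : Indecomposable U)
    (hp : IsPPermutation p U) :
    (∃ Q ∈ corefreePSubgroups p G, IsRelProjective Q U) ∨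
      ∃ P : Subgroup G, P.Normal ∧ IsPGroup p P ∧ P ≠ ⊥ ∧ ∀ g ∈ P, ∀ v, U.ρ g v = v := by
  obtain ⟨Q, γ, hγ, hQ, hfix, hiso⟩ := exists_isIso_traceHom hU hp
  have := hp.1
  by_cases hcore : Q ∈ corefreePSubgroups p G
  · exact Or.inl ⟨Q, hcore, isRelProjective_of_isIso γ hγ hiso⟩
  right
  simp only [corefreePSubgroups, Set.mem_ofPred_eq, not_and, not_forall] at hcore
  obtain ⟨P, hPn, hPQ, hP⟩ := hcore hQ
  refine ⟨P, hPn, hQ.to_le hPQ, hP, fun g hg v => ?_⟩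
  -- Every vector is a sum of terms `x γ (x⁻¹ w)`. As `P ≤ Q` fixes the image of `γ` and is normal,
  -- it fixes each term.
  obtain ⟨w, rfl⟩ := (bijective_of_isIso (traceHom U γ hγ)).2 v
  have h1 : (traceHom U γ hγ).hom w = cosetSum Q (fun x => U.ρ x (γ (U.ρ x⁻¹ w))) :=
    traceEnd_apply Q γ w
  rw [h1, map_cosetSum (U.ρ g)]
  congr 1
  funext x
  have h2 : g * x = x * (x⁻¹ * g * x) := by group
  have h3 : x⁻¹ * g * x ∈ P := by simpa using hPn.conj_mem g hg x⁻¹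
  rw [← mul_apply_apply, h2, mul_apply_apply, hfix _ (hPQ h3)]

end Rep

/-! ### Lifting maps through the Brauer construction. -/

theorem cosetSum_mem {G A σ : Type*} [Group G] [Finite G] [AddCommMonoid A] [SetLike σ A]
    [AddSubmonoidClass σ A] (T : σ) (H : Subgroup G) (F : G → A) (h : ∀ g, F g ∈ T) :
    cosetSum H F ∈ T := by
  have := Fintype.ofFinite (G ⧸ H)
  rw [cosetSum, finsum_eq_sum_of_fintype]
  exact sum_mem fun x _ => h _

namespace EndotrivialComplex

variable {k G V : Type*} [Field k] [Group G] [Finite G] [AddCommGroup V] [Module k V]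
  {ρ : Representation k G V} {p : ℕ} [Fact p.Prime] [CharP k p]

theorem relTrace_eq_zero {Q P : Subgroup G} (hP : IsPGroup p P) (hQ : Q < P) (m : V)
    (hm : ∀ g ∈ P, ρ g m = m) : relTrace ρ Q P m = 0 := by
  have h1 : relTrace ρ Q P m = cosetSum (Q.subgroupOf P) (fun _ => m) :=
    finsum_congr fun x => hm _ (x.out : P).2
  rw [h1, cosetSum_const, ← Nat.cast_smul_eq_nsmul k]
  obtain ⟨n, hn⟩ := hP.index (Q.subgroupOf P)
  have hn0 : n ≠ 0 := by
    rintro rfl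
    rw [pow_zero, Subgroup.index_eq_one, Subgroup.subgroupOf_eq_top] at hn
    exact hQ.not_ge hn
  rw [hn, Nat.cast_pow, CharP.cast_eq_zero, zero_pow hn0, zero_smul]

/-- On `P`-fixed vectors the trace from `Q < P` is multiplication by `[P : Q]`, a positive power of
`p`. Hence a map with `P`-fixed image factors through the Brauer quotient. -/
theorem map_eq_zero_of_mem_traceSubmodule {W : Type*} [AddCommGroup W] [Module k W]
    {σ : Representation k G W} {P : Subgroup G} (hP : IsPGroup p P) (f : ρ.IntertwiningMap σ)
    (hf : ∀ m, ∀ g ∈ P, σ g (f.toLinearMap m) = f.toLinearMap m)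
    (v : Representation.invariants (ρ.comp P.subtype)) (hv : v ∈ traceSubmodule ρ P) :
    f.toLinearMap v = 0 := by
  have : traceSubmodule ρ P ≤ LinearMap.ker (f.toLinearMap ∘ₗ Submodule.subtype _) := by
    refine Submodule.span_le.2 ?_
    rintro v ⟨Q, hQ, m, -, hv⟩
    change f.toLinearMap v = 0
    rw [hv, relTrace_map, relTrace_eq_zero hP hQ _ (hf m)]
  exact this hv

theorem map_mem_traceSubmodule {P : Subgroup G} [P.Normal] (g : G) {w : V}
    (hw : w ∈ (traceSubmodule ρ P).map (Submodule.subtype _)) :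
    ρ g w ∈ (traceSubmodule ρ P).map (Submodule.subtype _) := by
  obtain ⟨v, hv, rfl⟩ := hw
  exact ⟨_, traceSubmodule_le_comap ρ P (QuotientGroup.mk g) hv, rfl⟩

/-- The stabilizer of a point moved by `P` is a proper subgroup, so the orbit sum is one of the
traces divided out in the Brauer construction. -/
theorem cosetSum_stabilizer_mem_traceSubmodule {P : Subgroup G} {ι : Type*} [MulAction P ι] (i : ι)
    (hi : ∃ x : P, x • i ≠ i) (m : V) (hm : ∀ x : P, x • i = i → ρ x m = m) :
    cosetSum (MulAction.stabilizer P i) (fun x : P => ρ x m) ∈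
      (traceSubmodule ρ P).map (Submodule.subtype _) := by
  let Q := (MulAction.stabilizer P i).map P.subtype
  have hQ : Q.subgroupOf P = MulAction.stabilizer P i :=
    Subgroup.comap_map_eq_self_of_injective P.subtype_injective _
  have hlt : Q < P := by
    refine lt_of_le_of_ne (Subgroup.map_subtype_le _) fun h => ?_
    obtain ⟨x, hx⟩ := hi
    have : x ∈ Q.subgroupOf P := by rw [h, Subgroup.subgroupOf_self]; trivial
    rw [hQ] at this
    exact hx this
  have hcos : ∀ g : P, ∀ h ∈ MulAction.stabilizer P i, ρ ((g * h : P) : G) m = ρ g m := by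
    intro g h hh
    rw [Subgroup.coe_mul, Representation.mul_apply_apply, hm h hh]
  have hinv : cosetSum (MulAction.stabilizer P i) (fun x : P => ρ x m) ∈
      Representation.invariants (ρ.comp P.subtype) := by
    intro g
    change ρ g _ = _
    rw [map_cosetSum (ρ (g : G))]
    refine Eq.trans ?_ (cosetSum_mul_left hcos g)
    congr 1
    funext x
    rw [Subgroup.coe_mul, Representation.mul_apply_apply]
  refine ⟨⟨_, hinv⟩, Submodule.subset_span ⟨Q, hlt, m, ?_, ?_⟩, rfl⟩
  · rintro _ ⟨x, hx, rfl⟩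
    exact hm x hx
  · change cosetSum (MulAction.stabilizer P i) (fun x : P => ρ x m) =
      cosetSum (Q.subgroupOf P) (fun x : P => ρ x m)
    rw [hQ]

end EndotrivialComplex

namespace Rep

open Representation

variable {k : Type u} {G : Type u} [Field k] [Group G] [Finite G] {p : ℕ} [Fact p.Prime] [CharP k p]

/-- For a normal `p`-subgroup `P`, a `p`-permutation module `D` has an endomorphism with image in
`D^P` which induces the identity on `D(P)`. -/
theorem exists_endo_brauer {D : Rep.{u} k G} (hD : IsPPermutation p D) (P : Subgroup G) [P.Normal]
    (hP : IsPGroup p P) : ∃ φ : D ⟶ D, (∀ m, ∀ g ∈ P, D.ρ g (φ.hom m) = φ.hom m) ∧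
      ∀ m, (∀ g ∈ P, D.ρ g m = m) →
        φ.hom m - m ∈ (traceSubmodule D.ρ P).map (Submodule.subtype _) := by
  classical
  rw [isPPermutation_iff] at hD
  obtain ⟨hfin, hD⟩ := hD
  obtain ⟨S⟩ : Nonempty (Sylow p G) := inferInstance
  have hPS : P ≤ S := hP.le_sylow_of_normal S
  obtain ⟨ι, _, b₀, hb₀⟩ := (hD S S.isPGroup').exists_basis
  have : Module.Finite k (Rep.res (S : Subgroup G).subtype D).V := hfin
  have : Finite ι := Module.Finite.finite_basis b₀
  have := Fintype.ofFinite ι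
  let b : Module.Basis ι k D.V := b₀
  have hb : ∀ (s : S) i, D.ρ s (b i) = b (s • i) := hb₀
  let c : k := ((S : Subgroup G).index : k)⁻¹
  -- `F` selects the basis vectors fixed by `P`, and `e` projects onto their span. Normality of `P`
  -- makes `e` commute with `S`; tracing `c • e` up to `G` makes it `G`-equivariant.
  let F : ι → Prop := fun i => ∀ s : S, (s : G) ∈ P → s • i = i
  have hF : ∀ (s : S) i, F (s • i) ↔ F i := by
    have : ∀ (s : S) i, F i → F (s • i) := by
      intro s i hi t ht
      have h1 := hi (s⁻¹ * t * s) (by simpa using ‹P.Normal›.conj_mem t ht (s⁻¹ : S))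
      rw [mul_smul, mul_smul, inv_smul_eq_iff] at h1
      exact h1
    refine fun s i => ⟨fun h => ?_, this s i⟩
    simpa using this s⁻¹ _ h
  let e : D.V →ₗ[k] D.V := ∑ i, if F i then basisProj b i else 0
  have he : ∀ m, e m = ∑ i, if F i then b.repr m i • b i else 0 := by
    intro m
    rw [LinearMap.sum_apply]
    refine Finset.sum_congr rfl fun i _ => ?_
    split_ifs <;> rfl
  have hconj : ∀ s ∈ (S : Subgroup G), D.ρ.conjEnd s (c • e) = c • e := by
    intro s hs
    rw [conjEnd_smul]
    congr 1
    have h1 : D.ρ.conjEnd s e = ∑ i, D.ρ.conjEnd s (if F i then basisProj b i else 0) :=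
      map_sum (D.ρ.conjEndHom s) _ _
    rw [h1]
    refine Eq.trans ?_ (Equiv.sum_comp (MulAction.toPerm (⟨s, hs⟩ : S))
      (fun i => if F i then basisProj b i else 0))
    refine Finset.sum_congr rfl fun i _ => ?_
    rw [MulAction.toPerm_apply]
    by_cases h : F i
    · rw [if_pos h, if_pos ((hF _ i).2 h)]
      exact conjEnd_basisProj (ρ := D.ρ.comp (S : Subgroup G).subtype) b hb ⟨s, hs⟩ i
    · rw [if_neg h, if_neg (fun h' => h ((hF _ i).1 h'))]
      exact map_zero (D.ρ.conjEndHom s)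
  have hefix : ∀ m, ∀ g ∈ P, D.ρ g ((c • e) m) = (c • e) m := by
    intro m g hg
    rw [LinearMap.smul_apply, map_smul, he, map_sum]
    congr 1
    refine Finset.sum_congr rfl fun i _ => ?_
    by_cases h : F i
    · rw [if_pos h, map_smul]
      have := hb ⟨g, hPS hg⟩ i
      rw [h _ hg] at this
      rw [this]
    · rw [if_neg h, map_zero]
  have hetr : ∀ m, (∀ g ∈ P, D.ρ g m = m) →
      e m - m ∈ (traceSubmodule D.ρ P).map (Submodule.subtype _) := by
    intro m hm
    let act : MulAction P ι :=
      { smul := fun x i => (⟨x, hPS x.2⟩ : S) • i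
        one_smul := fun i => one_smul S i
        mul_smul := fun x y i => mul_smul (⟨x, hPS x.2⟩ : S) ⟨y, hPS y.2⟩ i }
    have hact : ∀ (x : P) (i : ι), x • i = (⟨x, hPS x.2⟩ : S) • i := fun _ _ => rfl
    have := Fintype.ofFinite (MulAction.orbitRel.Quotient P ι)
    have h1 : e m - m = - ∑ i, if F i then 0 else b.repr m i • b i := by
      rw [he]
      nth_rewrite 2 [← b.sum_repr m]
      rw [← Finset.sum_sub_distrib, ← Finset.sum_neg_distrib]
      refine Finset.sum_congr rfl fun i _ => ?_
      split_ifs <;> simp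
    -- The coordinates of a `P`-fixed vector are constant on `P`-orbits, so the discarded part is a
    -- sum of orbit sums over nontrivial orbits.
    rw [h1, sum_eq_sum_cosetSum_stabilizer (S := P)]
    refine neg_mem (sum_mem fun ω _ => ?_)
    by_cases h : F ω.out
    · have : ∀ x : P, (if F (x • ω.out) then 0 else b.repr m (x • ω.out) • b (x • ω.out)) = 0 :=
        fun x => if_pos ((hF _ _).2 h)
      simp only [this]
      rw [cosetSum_const, smul_zero]
      exact zero_mem _
    · have : ∀ x : P, (if F (x • ω.out) then 0 else b.repr m (x • ω.out) • b (x • ω.out)) =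
          D.ρ x (b.repr m ω.out • b ω.out) := by
        intro x
        rw [hact, if_neg (fun h' => h ((hF ⟨x, hPS x.2⟩ _).1 h')), map_smul (D.ρ x)]
        have h2 := repr_smul (ρ := D.ρ.comp (S : Subgroup G).subtype) b hb ⟨x, hPS x.2⟩ m ω.out
        have h3 : D.ρ.comp (S : Subgroup G).subtype ⟨x, hPS x.2⟩ m = m := hm x x.2
        rw [h3] at h2
        rw [h2, ← hb]
      simp only [this]
      refine cosetSum_stabilizer_mem_traceSubmodule ω.out ?_ _ ?_
      · simp only [F, not_forall] at h
        obtain ⟨s, hs, hs'⟩ := h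
        exact ⟨⟨s, hs⟩, hs'⟩
      · intro x hx
        rw [map_smul]
        have := hb ⟨x, hPS x.2⟩ ω.out
        rw [← hact, hx] at this
        rw [this]
  refine ⟨traceHom D (c • e) hconj, ?_, ?_⟩
  · intro m g hg
    have h1 : (traceHom D (c • e) hconj).hom m =
      cosetSum (S : Subgroup G) (fun x => D.ρ x ((c • e) (D.ρ x⁻¹ m))) := traceEnd_apply _ _ m
    rw [h1, map_cosetSum (D.ρ g)]
    congr 1
    funext x
    have h2 : g * x = x * (x⁻¹ * g * x) := by group
    have h3 : x⁻¹ * g * x ∈ P := by simpa using ‹P.Normal›.conj_mem g hg x⁻¹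
    rw [← mul_apply_apply, h2, mul_apply_apply, hefix _ _ h3]
  · intro m hm
    have h1 : (traceHom D (c • e) hconj).hom m =
      cosetSum (S : Subgroup G) (fun x => D.ρ x ((c • e) (D.ρ x⁻¹ m))) := traceEnd_apply _ _ m
    have h2 : cosetSum (S : Subgroup G) (fun _ => c • m) = m := by
      rw [cosetSum_const, ← Nat.cast_smul_eq_nsmul k, smul_smul,
        mul_inv_cancel₀ (sylow_index_ne_zero p S), one_smul]
    -- Replacing `e` by the identity gives exactly `m`, by the choice of `c`. The error is a sum of
    -- translates of errors of `e` on `P`-fixed vectors, which lie in the `G`-stable trace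
    -- submodule.
    have h3 : (traceHom D (c • e) hconj).hom m = m +
        cosetSum (S : Subgroup G) (fun x => c • D.ρ x (e (D.ρ x⁻¹ m) - D.ρ x⁻¹ m)) := by
      rw [h1]
      nth_rewrite 2 [← h2]
      rw [cosetSum, cosetSum, cosetSum, ← finsum_add_distrib (Set.toFinite _) (Set.toFinite _)]
      refine finsum_congr fun x => ?_
      rw [map_sub, apply_inv_apply, LinearMap.smul_apply, map_smul, smul_sub]
      abel
    rw [h3, add_sub_cancel_left]
    refine cosetSum_mem _ _ _ fun x => Submodule.smul_mem _ _ (map_mem_traceSubmodule x (hetr _ ?_))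
    intro g hg
    have h4 : g * x⁻¹ = x⁻¹ * (x * g * x⁻¹) := by group
    rw [← mul_apply_apply, h4, mul_apply_apply, hm _ (‹P.Normal›.conj_mem g hg x)]

end Rep

namespace Rep

open Representation

variable {k : Type u} {G : Type u} [Field k] [Group G] [Finite G] {p : ℕ} [Fact p.Prime] [CharP k p]

/-- On `p`-permutation modules the Brauer construction at a normal `p`-subgroup is full. -/
theorem exists_brauer_map_eq {D D' : Rep.{u} k G} (hD : IsPPermutation p D)
    (hD' : IsPPermutation p D') (P : Subgroup G) [P.Normal] (hP : IsPGroup p P)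
    (h : (brauer k P).obj D ⟶ (brauer k P).obj D') : ∃ H : D ⟶ D', (brauer k P).map H = h := by
  obtain ⟨φ, hφ1, hφ2⟩ := exists_endo_brauer hD P hP
  obtain ⟨φ', hφ1', hφ2'⟩ := exists_endo_brauer hD' P hP
  let T := traceSubmodule D.ρ P
  let T' := traceSubmodule D'.ρ P
  let a : D.V →ₗ[k] Representation.invariants (D.ρ.comp P.subtype) :=
    φ.hom.toLinearMap.codRestrict _ fun m g => hφ1 m g g.2
  -- The lift of `h` is the composite `D → D^P → D(P) → D'(P) → D'`. Its first map is `φ`, and its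
  -- last is `φ'`, which descends to the quotient because its image is `P`-fixed.
  let s : (Representation.invariants (D'.ρ.comp P.subtype) ⧸ T') →ₗ[k] D'.V :=
    T'.liftQ (φ'.hom.toLinearMap ∘ₗ Submodule.subtype _)
      fun v hv => map_eq_zero_of_mem_traceSubmodule hP φ'.hom hφ1' v hv
  let h' : (Representation.invariants (D.ρ.comp P.subtype) ⧸ T) →ₗ[k]
    (Representation.invariants (D'.ρ.comp P.subtype) ⧸ T') := h.hom.toLinearMap
  have hs : ∀ (g : G) (x : (brauer k P).obj D'),
      s (((brauer k P).obj D').ρ (QuotientGroup.mk g) x) = D'.ρ g (s x) := by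
    intro g x
    obtain ⟨w, rfl⟩ := Submodule.Quotient.mk_surjective _ x
    exact Rep.hom_comm_apply φ' g w
  have ha : ∀ (g : G) (m : D.V), T.mkQ (a (D.ρ g m)) =
      ((brauer k P).obj D).ρ (QuotientGroup.mk g) (T.mkQ (a m)) := by
    intro g m
    refine congrArg T.mkQ (Subtype.ext ?_)
    exact Rep.hom_comm_apply φ g m
  let H : D ⟶ D' := Rep.ofHom ⟨s ∘ₗ h' ∘ₗ T.mkQ ∘ₗ a, fun g => by
    ext m
    change s (h' (T.mkQ (a (D.ρ g m)))) = D'.ρ g (s (h' (T.mkQ (a m))))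
    exact (congrArg s ((congrArg h' (ha g m)).trans
      (Rep.hom_comm_apply h (QuotientGroup.mk g) (T.mkQ (a m))))).trans (hs g _)⟩
  refine ⟨H, eq_of_toLinearMap (LinearMap.ext fun x => ?_)⟩
  obtain ⟨v, rfl⟩ := Submodule.Quotient.mk_surjective _ x
  have h1 : T.mkQ (a v) = T.mkQ v := by
    rw [← sub_eq_zero, ← map_sub, Submodule.mkQ_apply, Submodule.Quotient.mk_eq_zero]
    obtain ⟨w, hw, hw'⟩ := hφ2 v (fun g hg => v.2 ⟨g, hg⟩)
    have : a v - v = w := Subtype.ext hw'.symm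
    rwa [this]
  obtain ⟨w, hw⟩ := Submodule.Quotient.mk_surjective _ (h' (T.mkQ v))
  have h2 : H.hom v = φ'.hom w := by
    change s (h' (T.mkQ (a v))) = _
    rw [h1, ← hw]
    rfl
  change T'.mkQ (invariantsMap H.hom P v) = h' (T.mkQ v)
  rw [← hw]
  change T'.mkQ (invariantsMap H.hom P v) = T'.mkQ w
  rw [← sub_eq_zero, ← map_sub, Submodule.mkQ_apply, Submodule.Quotient.mk_eq_zero]
  obtain ⟨t, ht, ht'⟩ := hφ2' w (fun g hg => w.2 ⟨g, hg⟩)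
  have : invariantsMap H.hom P v - w = t := Subtype.ext
    ((congrArg (· - (w : D'.V)) h2).trans ht'.symm)
  rwa [this]

/-- When `P` acts trivially every vector is fixed and all traces from proper subgroups vanish, so
the Brauer construction loses nothing. -/
theorem eq_zero_of_brauer_map_eq_zero {U U' : Rep.{u} k G} (P : Subgroup G) [P.Normal]
    (hP : IsPGroup p P) (hU : ∀ g ∈ P, ∀ v, U.ρ g v = v) (hU' : ∀ g ∈ P, ∀ v, U'.ρ g v = v)
    (θ : U ⟶ U') (hθ : (brauer k P).map θ = 0) : θ = 0 := by
  refine eq_of_toLinearMap (LinearMap.ext fun v => ?_)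
  have hv : v ∈ Representation.invariants (U.ρ.comp P.subtype) := fun g => hU g g.2 v
  have h1 := congrArg (fun f => f.hom ((traceSubmodule U.ρ P).mkQ ⟨v, hv⟩)) hθ
  have h2 : (traceSubmodule U'.ρ P).mkQ (invariantsMap θ.hom P ⟨v, hv⟩) = 0 := h1
  rw [Submodule.mkQ_apply, Submodule.Quotient.mk_eq_zero] at h2
  exact map_eq_zero_of_mem_traceSubmodule hP (Representation.IntertwiningMap.id U'.ρ)
    (fun m g hg => hU' g hg m) _ h2

/-- The Brauer construction of the trivial module is trivial. -/
noncomputable def brauerTrivialIso (P : Subgroup G) [P.Normal] (hP : IsPGroup p P) :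
    (brauer k P).obj (Rep.trivial k G k) ≅ Rep.trivial k (G ⧸ P) k where
  hom := Rep.ofHom ⟨(traceSubmodule (Rep.trivial k G k).ρ P).liftQ
      (Submodule.subtype _) fun v hv => map_eq_zero_of_mem_traceSubmodule (p := p) hP
        (Representation.IntertwiningMap.id (Rep.trivial k G k).ρ) (fun _ _ _ => rfl) v hv, fun g => by
    induction g using QuotientGroup.induction_on with
    | H g => exact Submodule.linearMap_qext _ (LinearMap.ext fun v => rfl)⟩
  inv := Rep.ofHom ⟨(traceSubmodule (Rep.trivial k G k).ρ P).mkQ ∘ₗ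
      LinearMap.codRestrict _ LinearMap.id (fun _ _ => rfl), fun g => by
    induction g using QuotientGroup.induction_on with
    | H g => rfl⟩
  hom_inv_id := by
    refine eq_of_toLinearMap (LinearMap.ext fun x => ?_)
    obtain ⟨v, rfl⟩ := Submodule.Quotient.mk_surjective _ x
    rfl
  inv_hom_id := rfl

end Rep

/-! ### Splitting off contractible summands. -/

namespace ChainComplex

variable {𝒞 : Type*} [Category 𝒞] [Abelian 𝒞] (D : ChainComplex 𝒞 ℤ) {U : 𝒞} (b : ℤ)
  (i : U ⟶ D.X (b + 1)) (r : D.X b ⟶ U)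

/-- The family of maps which is `r ≫ i` from degree `b` to degree `b + 1` and zero elsewhere. -/
noncomputable def singleHom (x y : ℤ) : D.X x ⟶ D.X y :=
  if h : x = b ∧ y = b + 1 then eqToHom (by rw [h.1]) ≫ r ≫ i ≫ eqToHom (by rw [h.2]) else 0

theorem singleHom_self : singleHom D b i r b (b + 1) = r ≫ i := by
  simp [singleHom]

theorem singleHom_of_ne {x : ℤ} (y : ℤ) (h : x ≠ b) : singleHom D b i r x y = 0 := by
  simp [singleHom, h]

/-- The null-homotopic endomorphism defined by `singleHom`. -/
noncomputable def singleEndo : D ⟶ D := Homotopy.nullHomotopicMap (singleHom D b i r)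

theorem singleEndo_f (x y z : ℤ) (hxy : y + 1 = x) (hyz : x + 1 = z) :
    (singleEndo D b i r).f x =
      D.d x y ≫ singleHom D b i r y x + singleHom D b i r x z ≫ D.d z x :=
  Homotopy.nullHomotopicMap_f (c := ComplexShape.down ℤ) hyz hxy _

variable (h : i ≫ D.d (b + 1) b ≫ r = 𝟙 U)
include h

/-- Writing `s` for `singleHom`, the hypothesis gives `s d s = s`, while `s s = 0` for degree
reasons and `d d = 0`. So `d s + s d` is idempotent, projecting onto a copy of `U = U` in degrees `b
+ 1` and `b`. -/
theorem singleEndo_idem : singleEndo D b i r ≫ singleEndo D b i r = singleEndo D b i r := by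
  have h1 : ∀ y z, y + 1 = z → singleHom D b i r y z ≫ D.d z y ≫ singleHom D b i r y z =
      singleHom D b i r y z := by
    rintro y z rfl
    by_cases hy : y = b
    · subst hy
      rw [singleHom_self]
      simp only [Category.assoc]
      rw [← Category.assoc (D.d _ _), ← Category.assoc i, h, Category.id_comp]
    · rw [singleHom_of_ne D b i r _ hy, zero_comp]
  have h2 : ∀ x y z, x + 1 = y → y + 1 = z →
      singleHom D b i r x y ≫ singleHom D b i r y z = 0 := by
    rintro x y z hxy hyz
    by_cases hx : x = b
    · rw [singleHom_of_ne D b i r z (by omega), comp_zero]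
    · rw [singleHom_of_ne D b i r y hx, zero_comp]
  ext x
  rw [HomologicalComplex.comp_f, singleEndo_f D b i r x (x - 1) (x + 1) (by omega) rfl]
  simp only [Preadditive.add_comp, Preadditive.comp_add, Category.assoc]
  rw [h1 _ _ (by omega), ← Category.assoc (singleHom D b i r (x - 1) x),
    h2 _ _ _ (by omega) rfl, ← Category.assoc (D.d (x + 1) x), D.d_comp_d, zero_comp, comp_zero,
    zero_comp, comp_zero]
  have h3 := congrArg (· ≫ D.d (x + 1) x) (h1 x (x + 1) rfl)
  simp only [Category.assoc] at h3
  rw [h3, add_zero, zero_add]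

theorem comp_singleEndo_f : i ≫ (singleEndo D b i r).f (b + 1) = i := by
  rw [singleEndo_f D b i r (b + 1) b (b + 1 + 1) rfl rfl, singleHom_self,
    singleHom_of_ne D b i r _ (by omega), zero_comp, add_zero, ← Category.assoc (D.d _ _),
    ← Category.assoc, h, Category.id_comp]

/-- A contractible summand `U = U` of a complex can be split off. -/
theorem exists_split_contractible : ∃ (D' : ChainComplex 𝒞 ℤ) (j : D' ⟶ D) (q : D ⟶ D'),
    j ≫ q = 𝟙 D' ∧ i ≫ q.f (b + 1) = 0 ∧ Nonempty (HomotopyEquiv D D') := by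
  have he := singleEndo_idem D b i r h
  obtain ⟨D', j, q, hj, hq⟩ := exists_split_idempotent (𝟙 D - singleEndo D b i r) (by simp [he])
  refine ⟨D', j, q, hj, ?_, ⟨⟨q, j, ?_, Homotopy.ofEq hj⟩⟩⟩
  · have h1 : i ≫ (q ≫ j).f (b + 1) = 0 := by
      rw [hq, HomologicalComplex.sub_f_apply, Preadditive.comp_sub, comp_singleEndo_f D b i r h,
        HomologicalComplex.id_f, Category.comp_id, sub_self]
    have h2 := congrArg (fun f : D' ⟶ D' => f.f (b + 1)) hj
    have h3 : j.f (b + 1) ≫ q.f (b + 1) = 𝟙 _ := h2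
    have h4 := congrArg (· ≫ q.f (b + 1)) h1
    simpa [h3] using h4
  -- The projection onto `D'` differs from the identity by the null-homotopic idempotent.
  · refine Homotopy.symm (Homotopy.equivSubZero.symm ?_)
    rw [hq, sub_sub_cancel]
    refine Homotopy.nullHomotopy (singleHom D b i r) fun x y hxy => ?_
    by_cases hx : x = b
    · have : y ≠ b + 1 := fun hy => hxy (by simp [hx, hy])
      simp [singleHom, this]
    · exact singleHom_of_ne D b i r y hx

end ChainComplex

namespace Rep

variable {k : Type u} {G : Type u} [Field k] [Group G] [Finite G] {p : ℕ} [Fact p.Prime] [CharP k p]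

omit [Finite G] in
theorem finrank_le_of_retract {U X : Rep.{u} k G} [Module.Finite k X.V] (h : Retract U X) :
    Module.finrank k U.V ≤ Module.finrank k X.V :=
  LinearMap.finrank_le_finrank_of_injective (f := h.i.hom.toLinearMap) (retract_injective h)

omit [Finite G] in
theorem finrank_lt_of_retract {U X Y : Rep.{u} k G} [Module.Finite k X.V] (h : Retract U X)
    (i : Y ⟶ X) (hi : i ≠ 0) (hir : i ≫ h.r = 0) :
    Module.finrank k U.V < Module.finrank k X.V := by
  have hinj : Function.Injective h.i.hom.toLinearMap := retract_injective h
  rw [← LinearMap.finrank_range_of_inj hinj]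
  refine Submodule.finrank_lt fun htop => hi ?_
  refine Rep.hom_ext (Representation.IntertwiningMap.ext (LinearMap.ext fun y => ?_))
  obtain ⟨u, hu⟩ : i.hom y ∈ LinearMap.range h.i.hom.toLinearMap := htop ▸ Submodule.mem_top
  have h1 : h.r.hom (i.hom y) = 0 := congrArg (fun f : Y ⟶ U => f.hom y) hir
  have h2 : h.r.hom (h.i.hom u) = u := congrArg (fun f : U ⟶ U => f.hom u) h.retract
  have hu' : h.i.hom u = i.hom y := hu
  rw [hu', h1] at h2
  have h3 : i.hom y = 0 := by rw [← hu', ← h2, map_zero]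
  exact h3

/-- A bounded complex of `p`-permutation modules is homotopy equivalent to one without contractible
direct summands. -/
theorem exists_minimal (C : ChainComplex (Rep.{u} k G) ℤ) (hC : IsBoundedPPermutation p C) :
    ∃ D : ChainComplex (Rep.{u} k G) ℤ, IsBoundedPPermutation p D ∧ Nonempty (HomotopyEquiv C D) ∧
      ∀ (U : Rep.{u} k G) (x y : ℤ) (i : U ⟶ D.X x) (r : D.X y ⟶ U), ¬ IsZero U →
        ¬ IsIso (i ≫ D.d x y ≫ r) := by
  classical
  obtain ⟨⟨m, n, hmn⟩, hperm⟩ := hC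
  -- Take `D` of least total dimension among complexes supported in the fixed range `[m, n]`;
  -- splitting off a nonzero contractible summand would lower it.
  let A : ℕ → Prop := fun N => ∃ D : ChainComplex (Rep.{u} k G) ℤ,
    (∀ i, i < m ∨ n < i → IsZero (D.X i)) ∧ (∀ i, IsPPermutation p (D.X i)) ∧
      Nonempty (HomotopyEquiv C D) ∧ ∑ j ∈ Finset.Icc m n, Module.finrank k (D.X j).V = N
  have hA : ∃ N, A N := ⟨_, C, hmn, hperm, ⟨HomotopyEquiv.refl C⟩, rfl⟩
  obtain ⟨D, hD0, hDp, ⟨hCD⟩, hDN⟩ := Nat.find_spec hA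
  refine ⟨D, ⟨⟨m, n, hD0⟩, hDp⟩, ⟨hCD⟩, fun U x y i r hU hiso => ?_⟩
  have hxy : y + 1 = x := by
    by_contra hne
    have : D.d x y = 0 := D.shape _ _ hne
    rw [this, zero_comp, comp_zero] at hiso
    exact hU (IsZero.of_mono_zero U U)
  subst hxy
  have hid : i ≫ D.d (y + 1) y ≫ (r ≫ inv (i ≫ D.d (y + 1) y ≫ r)) = 𝟙 U := by
    have := IsIso.hom_inv_id (i ≫ D.d (y + 1) y ≫ r)
    simpa only [Category.assoc] using this
  have hi0 : i ≠ 0 := by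
    rintro rfl
    rw [zero_comp] at hid
    exact hU ((IsZero.iff_id_eq_zero U).2 hid.symm)
  obtain ⟨D', j, q, hj, hiq, ⟨e⟩⟩ := ChainComplex.exists_split_contractible D y i _ hid
  let R : ∀ z, Retract (D'.X z) (D.X z) := fun z =>
    ⟨j.f z, q.f z, congrArg (fun f : D' ⟶ D' => f.f z) hj⟩
  have hfin : ∀ z, Module.Finite k (D.X z).V := fun z => (hDp z).1
  have hlt : ∑ z ∈ Finset.Icc m n, Module.finrank k (D'.X z).V < Nat.find hA := by
    rw [← hDN]
    refine Finset.sum_lt_sum (fun z _ => finrank_le_of_retract (R z)) ⟨y + 1, ?_, ?_⟩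
    · rw [Finset.mem_Icc]
      by_contra hne
      exact hi0 ((hD0 (y + 1) (by omega)).eq_of_tgt _ _)
    · exact finrank_lt_of_retract (R (y + 1)) i hi0 hiq
  refine Nat.find_min hA hlt ⟨D', fun z hz => ?_, fun z => (hDp z).of_retract (R z),
    ⟨hCD.trans e⟩, rfl⟩
  rw [IsZero.iff_id_eq_zero, ← (R z).retract, (hD0 z hz).eq_of_tgt (R z).i 0, zero_comp]

end Rep

/-! ### Endomorphisms of nonzero trace from endotriviality. -/

namespace Rep

open Representation

variable {k : Type u} {G : Type u} [Field k] [Group G]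

/-- If the trivial module is a direct summand of `M^* ⊗ M`, then `M` has an endomorphism of nonzero
trace. -/
theorem exists_trace_ne_zero_of_comp_ne_zero {M : Rep.{u} k G} [Module.Finite k M.V]
    (a : Rep.trivial k G k ⟶ dual M ⊗ M) (c : dual M ⊗ M ⟶ Rep.trivial k G k) (h : a ≫ c ≠ 0) :
    ∃ γ : M ⟶ M, LinearMap.trace k M.V γ.hom.toLinearMap ≠ 0 := by
  obtain ⟨x, hx⟩ : ∃ x : k, c.hom (a.hom x) ≠ 0 := by
    by_contra! hall
    exact h (Rep.hom_ext (IntertwiningMap.ext (LinearMap.ext hall)))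
  let t : TensorProduct k (Module.Dual k M.V) M.V := a.hom x
  have ht : ∀ g, TensorProduct.map (M.ρ.dual g) (M.ρ g) t = t := fun g =>
    (Rep.hom_comm_apply a g x).symm
  let c' : TensorProduct k (Module.Dual k M.V) M.V →ₗ[k] k := c.hom.toLinearMap
  have hc' : ∀ g s, c' (TensorProduct.map (M.ρ.dual g) (M.ρ g) s) = c' s := fun g s =>
    Rep.hom_comm_apply c g s
  -- `δ` corresponds to the form `c` by `φ (δ m) = c (φ ⊗ m)`, and `τ` below to the invariant tensor
  -- `a x`. Both commute with `G`, and the trace of `δ ∘ τ` is `c (a x)`.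
  let δ : M.V →ₗ[k] M.V :=
    (Module.evalEquiv k M.V).symm.toLinearMap ∘ₗ (TensorProduct.curry c').flip
  have hδ : ∀ (φ : Module.Dual k M.V) m, φ (δ m) = c' (φ ⊗ₜ m) := by
    intro φ m
    have := Module.apply_evalEquiv_symm_apply (R := k) (M := M.V) φ ((TensorProduct.curry c').flip m)
    exact this
  have hδg : ∀ g, δ ∘ₗ M.ρ g = M.ρ g ∘ₗ δ := by
    intro g
    ext m
    apply (Module.evalEquiv k M.V).injective
    ext φ
    change φ (δ (M.ρ g m)) = φ (M.ρ g (δ m))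
    have h1 : φ (M.ρ g (δ m)) = (φ ∘ₗ M.ρ g) (δ m) := rfl
    rw [hδ, h1, hδ, ← hc' g ((φ ∘ₗ M.ρ g) ⊗ₜ m)]
    congr 1
    rw [TensorProduct.map_tmul]
    congr 1
    ext v
    change φ v = φ (M.ρ g (M.ρ g⁻¹ v))
    rw [apply_inv_apply]
  let τ : M.V →ₗ[k] M.V := dualTensorHom k M.V M.V t
  have hτ : ∀ g, τ ∘ₗ M.ρ g = M.ρ g ∘ₗ τ := by
    intro g
    have h1 := LinearMap.congr_fun (dualTensorHom_comm M.ρ M.ρ g) t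
    rw [LinearMap.comp_apply, LinearMap.comp_apply, ht, linHom_apply] at h1
    change τ = M.ρ g ∘ₗ τ ∘ₗ M.ρ g⁻¹ at h1
    ext v
    rw [h1]
    change M.ρ g (τ (M.ρ g⁻¹ (M.ρ g v))) = M.ρ g (M.ρ g (τ (M.ρ g⁻¹ v)))
    rw [inv_apply_apply]
    have h2 := LinearMap.congr_fun h1 v
    change τ v = M.ρ g (τ (M.ρ g⁻¹ v)) at h2
    rw [← h2]
  have key : ∀ s : TensorProduct k (Module.Dual k M.V) M.V,
      LinearMap.trace k M.V (δ ∘ₗ dualTensorHom k M.V M.V s) = c' s := by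
    intro s
    induction s using TensorProduct.induction_on with
    | zero => simp
    | add s t hs ht => rw [map_add, LinearMap.comp_add, map_add, hs, ht, map_add]
    | tmul φ m =>
      have h1 : δ ∘ₗ dualTensorHom k M.V M.V (φ ⊗ₜ m) = dualTensorHom k M.V M.V (φ ⊗ₜ δ m) := by
        ext v
        simp [dualTensorHom_apply]
      rw [h1, LinearMap.trace_eq_contract_apply, contractLeft_apply, hδ]
  refine ⟨Rep.ofHom ⟨δ ∘ₗ τ, fun g => ?_⟩, ?_⟩
  · rw [LinearMap.comp_assoc, hτ, ← LinearMap.comp_assoc, hδg, LinearMap.comp_assoc]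
  · exact (key t).trans_ne hx

end Rep

namespace EndotrivialComplex

section Tensor

variable {𝒞 : Type*} [Category 𝒞] [Preadditive 𝒞] {X : 𝒞} {Y : ℤ → 𝒞} (ι : ∀ i, Y i ⟶ X)

/-- `hdesc` and `hext` say that `X` is the coproduct of the `Y i`. Only finitely many are nonzero,
so `X` is a biproduct and `f ≫ g` is the sum of its components through the `Y i`. -/
theorem exists_comp_ne_zero (hdesc : ∀ (Z : 𝒞) (f : ∀ i, Y i ⟶ Z), ∃ g : X ⟶ Z, ∀ i, ι i ≫ g = f i)
    (hext : ∀ (Z : 𝒞) (g g' : X ⟶ Z), (∀ i, ι i ≫ g = ι i ≫ g') → g = g')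
    (hbdd : ∃ a b : ℤ, ∀ i, i < a ∨ b < i → IsZero (Y i)) {T : 𝒞} (f : T ⟶ X) (g : X ⟶ T)
    (hfg : f ≫ g ≠ 0) : ∃ (i : ℤ) (f' : T ⟶ Y i) (g' : Y i ⟶ T), f' ≫ g' ≠ 0 := by
  classical
  obtain ⟨a, b, hab⟩ := hbdd
  have hπ : ∀ i, ∃ π : X ⟶ Y i, ∀ j, ι j ≫ π = if h : j = i then eqToHom (by rw [h]) else 0 :=
    fun i => hdesc (Y i) fun j => if h : j = i then eqToHom (by rw [h]) else 0
  choose π hπ using hπ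
  have hsum : ∑ i ∈ Finset.Icc a b, π i ≫ ι i = 𝟙 X := by
    refine hext _ _ _ fun j => ?_
    by_cases hj : j ∈ Finset.Icc a b
    · rw [Preadditive.comp_sum, Finset.sum_eq_single j]
      · rw [← Category.assoc, hπ, dif_pos rfl, eqToHom_refl, Category.id_comp, Category.comp_id]
      · intro i _ hij
        rw [← Category.assoc, hπ, dif_neg (Ne.symm hij), zero_comp]
      · exact fun h => absurd hj h
    · refine (hab j ?_).eq_of_src _ _
      rw [Finset.mem_Icc] at hj
      omega
  by_contra! hall
  refine hfg ?_
  rw [← Category.id_comp g, ← hsum, Preadditive.sum_comp, Preadditive.comp_sum]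
  refine Finset.sum_eq_zero fun i _ => ?_
  have := hall i (f ≫ π i) (ι i ≫ g)
  simpa only [Category.assoc] using this

end Tensor

variable {k : Type u} {G : Type u} [Field k] [Group G] {p : ℕ}

theorem IsEndotrivial.exists_trace_ne_zero {C : ChainComplex (Rep.{u} k G) ℤ}
    (hC : IsEndotrivial p C) :
    ∃ (i : ℤ) (γ : C.X i ⟶ C.X i), LinearMap.trace k (C.X i).V γ.hom.toLinearMap ≠ 0 := by
  obtain ⟨⟨⟨m, n, hmn⟩, hperm⟩, ⟨e⟩⟩ := hC
  let K := HomologicalComplex.tensorObj (dualComplex C) C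
  let s : (trivialComplex k G).X 0 ≅ Rep.trivial k G k :=
    HomologicalComplex.singleObjXSelf (ComplexShape.down ℤ) 0 _
  have hz : ∀ i : ℤ, i ≠ 0 → IsZero ((trivialComplex k G).X i) := fun i hi =>
    HomologicalComplex.isZero_single_obj_X (ComplexShape.down ℤ) 0 _ i hi
  -- The homotopy on `k[0]` vanishes since its neighbouring terms are zero; the composite is the
  -- identity on the nose.
  have hid : e.inv.f 0 ≫ e.hom.f 0 = 𝟙 ((trivialComplex k G).X 0) := by
    have h1 := e.homotopyInvHomId.comm 0
    rw [dNext_eq (i := (0 : ℤ)) (i' := -1) _ (by simp), prevD_eq (j := (0 : ℤ)) (j' := 1) _ (by simp),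
      (hz (-1) (by omega)).eq_of_src (e.homotopyInvHomId.hom _ _) 0,
      (hz 1 (by omega)).eq_of_tgt (e.homotopyInvHomId.hom _ _) 0, comp_zero, zero_comp, zero_add,
      zero_add] at h1
    exact h1
  have hne : (s.inv ≫ e.inv.f 0) ≫ (e.hom.f 0 ≫ s.hom) ≠ 0 := by
    have h1 : (s.inv ≫ e.inv.f 0) ≫ (e.hom.f 0 ≫ s.hom) = 𝟙 (Rep.trivial k G k) := by
      rw [Category.assoc, ← Category.assoc (e.inv.f 0), hid, Category.id_comp, s.inv_hom_id]
    rw [h1]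
    intro h2
    have h3 : (1 : k) = 0 :=
      congrArg (fun f : Rep.trivial k G k ⟶ Rep.trivial k G k => f.hom (1 : k)) h2
    exact one_ne_zero h3
  obtain ⟨i, f', g', hi⟩ := exists_comp_ne_zero
    (Y := fun i : ℤ => (dualComplex C).X i ⊗ C.X (-i))
    (fun i => HomologicalComplex.ιTensorObj (dualComplex C) C i (-i) 0 (by omega))
    (by
      intro Z f
      refine ⟨HomologicalComplex.mapBifunctorDesc fun i₁ i₂ h =>
        eqToHom (by
          have h' : i₁ + i₂ = 0 := h
          obtain rfl : i₂ = -i₁ := by omega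
          rfl) ≫ f i₁, fun i => ?_⟩
      rw [HomologicalComplex.ι_mapBifunctorDesc]
      simp)
    (by
      intro Z g g' h
      refine HomologicalComplex.mapBifunctor.hom_ext fun i₁ i₂ h' => ?_
      have h'' : i₁ + i₂ = 0 := h'
      obtain rfl : i₂ = -i₁ := by omega
      exact h i₁)
    ⟨-n, -m, fun i hi => by
      have h1 : IsZero (C.X (-i)) := hmn _ (by omega)
      have h2 : IsZero ((tensorLeft ((dualComplex C).X i)).obj (C.X (-i))) :=
        Functor.map_isZero _ h1
      exact h2⟩
    _ _ hne
  have := (hperm (-i)).1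
  exact ⟨-i, Rep.exists_trace_ne_zero_of_comp_ne_zero f' g' hi⟩

end EndotrivialComplex

/-! ### Indecomposable summands of a minimal complex. -/

namespace Rep

open Representation

variable {k : Type u} {G : Type u} [Field k] [Group G]

theorem trace_comp_comm {M N : Rep.{u} k G} [Module.Finite k M.V] [Module.Finite k N.V]
    (f : M ⟶ N) (g : N ⟶ M) :
    LinearMap.trace k M.V (f ≫ g).hom.toLinearMap =
      LinearMap.trace k N.V (g ≫ f).hom.toLinearMap :=
  LinearMap.trace_comp_comm' _ _

theorem exists_indecomposable_retract_trace_ne_zero {M : Rep.{u} k G} [Module.Finite k M.V]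
    (γ : M ⟶ M) (hγ : LinearMap.trace k M.V γ.hom.toLinearMap ≠ 0) :
    ∃ (N : Rep.{u} k G) (_ : Retract N M) (δ : N ⟶ N), Indecomposable N ∧
      LinearMap.trace k N.V δ.hom.toLinearMap ≠ 0 := by
  induction hn : Module.finrank k M.V using Nat.strong_induction_on generalizing M with
  | _ n ih =>
    subst hn
    have h0 : ¬ IsZero M := by
      intro h
      apply hγ
      rw [h.eq_of_src γ 0]
      exact map_zero (LinearMap.trace k M.V)
    rcases indecomposable_or_exists_sum M h0 with h | ⟨Y, Z, i, q, j, r, h1, h2, h3, h4, h5, hY, hZ⟩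
    · exact ⟨M, Retract.refl M, γ, h, hγ⟩
    have hfY : Module.Finite k Y.V := finite_of_retract ⟨i, q, h1⟩
    have hfZ : Module.Finite k Z.V := finite_of_retract ⟨j, r, h2⟩
    -- The trace is the sum of the traces of the diagonal blocks, so one of the two smaller summands
    -- keeps a nonzero trace.
    have hsum : LinearMap.trace k M.V γ.hom.toLinearMap =
        LinearMap.trace k Y.V (i ≫ γ ≫ q).hom.toLinearMap +
          LinearMap.trace k Z.V (j ≫ γ ≫ r).hom.toLinearMap := by
      rw [trace_comp_comm i, trace_comp_comm j, ← map_add]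
      congr 1
      have h6 : γ = (γ ≫ q) ≫ i + (γ ≫ r) ≫ j := by
        rw [Category.assoc, Category.assoc, ← Preadditive.comp_add, h5, Category.comp_id]
      conv_lhs => rw [h6]
      rfl
    by_cases hY0 : LinearMap.trace k Y.V (i ≫ γ ≫ q).hom.toLinearMap = 0
    · rw [hY0, zero_add] at hsum
      obtain ⟨N, R, δ, hN, hδ⟩ := ih _ hZ (j ≫ γ ≫ r) (hsum ▸ hγ) rfl
      exact ⟨N, R.trans ⟨j, r, h2⟩, δ, hN, hδ⟩
    · obtain ⟨N, R, δ, hN, hδ⟩ := ih _ hY (i ≫ γ ≫ q) hY0 rfl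
      exact ⟨N, R.trans ⟨i, q, h1⟩, δ, hN, hδ⟩

theorem indecomposable_trivial : Indecomposable (Rep.trivial k G k) := by
  refine indecomposable_of_idempotents ?_ fun e he => ?_
  · rw [isZero_iff_subsingleton]
    exact not_subsingleton k
  · let c : k := e.hom (1 : k)
    have hc : ∀ x : k, e.hom x = x * c := by
      intro x
      have := map_smul e.hom x (1 : k)
      rw [smul_eq_mul, mul_one] at this
      exact this
    have h1 : c * c = c := by
      have h2 : e.hom (e.hom (1 : k)) = e.hom (1 : k) :=
        congrArg (fun f : Rep.trivial k G k ⟶ Rep.trivial k G k => f.hom (1 : k)) he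
      exact (hc c).symm.trans h2
    rcases IsIdempotentElem.iff_eq_zero_or_one.1 h1 with h | h
    · left
      refine eq_of_toLinearMap (LinearMap.ext fun x => (hc x).trans ?_)
      rw [h, mul_zero]
      rfl
    · right
      refine eq_of_toLinearMap (LinearMap.ext fun x => (hc x).trans ?_)
      rw [h, mul_one]
      rfl

variable [Finite G] {p : ℕ} [Fact p.Prime] [CharP k p]

section Brauer

variable {D : ChainComplex (Rep.{u} k G) ℤ} (hD : ∀ i, IsPPermutation p (D.X i))
  (hmin : ∀ (U : Rep.{u} k G) (x y : ℤ) (i : U ⟶ D.X x) (r : D.X y ⟶ U), ¬ IsZero U →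
    ¬ IsIso (i ≫ D.d x y ≫ r))
  (P : Subgroup G) [P.Normal] (hP : IsPGroup p P)
  (e : HomotopyEquiv (((brauer k P).mapHomologicalComplex (ComplexShape.down ℤ)).obj D)
    (trivialComplex k (G ⧸ P)))
include hD hmin hP

/-- If `f` agrees with the identity up to a homotopy after applying the Brauer construction, then
`f` restricts to an automorphism of each indecomposable summand on which `P` acts trivially. -/
theorem isIso_of_brauer_map_eq {j : ℤ} (f : D.X j ⟶ D.X j)
    (h : (brauer k P).obj (D.X (j - 1)) ⟶ (brauer k P).obj (D.X j))
    (h' : (brauer k P).obj (D.X j) ⟶ (brauer k P).obj (D.X (j + 1)))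
    (hf : (brauer k P).map f = (brauer k P).map (D.d j (j - 1)) ≫ h +
      h' ≫ (brauer k P).map (D.d (j + 1) j) + 𝟙 _)
    {U : Rep.{u} k G} (hU : Indecomposable U) (hPU : ∀ g ∈ P, ∀ v, U.ρ g v = v)
    (i : U ⟶ D.X j) (r : D.X j ⟶ U) (hir : i ≫ r = 𝟙 U) : IsIso (i ≫ f ≫ r) := by
  obtain ⟨H, rfl⟩ := exists_brauer_map_eq (hD _) (hD _) P hP h
  obtain ⟨H', rfl⟩ := exists_brauer_map_eq (hD _) (hD _) P hP h'
  have := (hD j).1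
  have hfin : Module.Finite k U.V := finite_of_retract ⟨i, r, hir⟩
  have h1 : i ≫ (f - (D.d j (j - 1) ≫ H + H' ≫ D.d (j + 1) j + 𝟙 _)) ≫ r = 0 := by
    refine eq_zero_of_brauer_map_eq_zero P hP hPU hPU _ ?_
    have h2 : (brauer k P).map (f - (D.d j (j - 1) ≫ H + H' ≫ D.d (j + 1) j + 𝟙 _)) = 0 := by
      rw [Functor.map_sub, Functor.map_add, Functor.map_add, Functor.map_comp, Functor.map_comp,
        CategoryTheory.Functor.map_id, hf, sub_self]
    rw [Functor.map_comp, Functor.map_comp, h2, zero_comp, comp_zero]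
  -- Locality makes one of the three terms invertible. The last two factor through a differential,
  -- which minimality excludes.
  have h2 : i ≫ f ≫ r + (i ≫ D.d j (j - 1) ≫ (-H ≫ r) + (-i ≫ H') ≫ D.d (j + 1) j ≫ r) = 𝟙 U := by
    rw [← sub_eq_zero, ← h1]
    simp only [Preadditive.comp_add, Preadditive.add_comp, Preadditive.comp_sub,
      Preadditive.sub_comp, Preadditive.neg_comp, Preadditive.comp_neg, Category.assoc,
      Category.id_comp, hir]
    abel
  rcases isIso_or_isIso_of_add hU _ _ (h2 ▸ (inferInstance : IsIso (𝟙 U))) with h3 | h3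
  · exact h3
  rcases isIso_or_isIso_of_add hU _ _ h3 with h4 | h4
  · exact absurd h4 (hmin _ _ _ _ _ hU.1)
  · exact absurd h4 (hmin _ _ _ _ _ hU.1)

include e

omit hD hmin hP [Fact p.Prime] [CharP k p] in
theorem hom_inv_eq (j : ℤ) : ∃ (h : (brauer k P).obj (D.X (j - 1)) ⟶ (brauer k P).obj (D.X j))
    (h' : (brauer k P).obj (D.X j) ⟶ (brauer k P).obj (D.X (j + 1))),
    e.hom.f j ≫ e.inv.f j = (brauer k P).map (D.d j (j - 1)) ≫ h +
      h' ≫ (brauer k P).map (D.d (j + 1) j) + 𝟙 _ := by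
  have h1 := e.homotopyHomInvId.comm j
  rw [dNext_eq (i := j) (i' := j - 1) _ (by simp), prevD_eq (j := j) (j' := j + 1) _ (by simp)] at h1
  exact ⟨_, _, h1⟩

theorem not_retract_of_acts_trivially {j : ℤ} (hj : j ≠ 0) {U : Rep.{u} k G}
    (hU : Indecomposable U) (hPU : ∀ g ∈ P, ∀ v, U.ρ g v = v) (R : Retract U (D.X j)) : False := by
  obtain ⟨h, h', hh⟩ := hom_inv_eq P e j
  have hz : IsZero ((trivialComplex k (G ⧸ P)).X j) :=
    HomologicalComplex.isZero_single_obj_X (ComplexShape.down ℤ) 0 _ j hj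
  -- In degree `j ≠ 0` the equivalence factors through zero, so `f = 0` is homotopic to the identity
  -- after applying the Brauer construction.
  have h1 := isIso_of_brauer_map_eq hD hmin P hP 0 h h' (by
    refine Eq.trans ?_ hh
    rw [hz.eq_of_tgt (e.hom.f j) 0, zero_comp, Functor.map_zero]
    rfl) hU hPU R.i R.r R.retract
  rw [zero_comp, comp_zero] at h1
  exact hU.1 (IsZero.of_mono_zero U U)

/-- The trivial module is a direct summand of `D_0`, and it is the only summand on which `P`
acts trivially. -/
theorem exists_trivial_retract : ∃ R : Retract (Rep.trivial k G k) (D.X 0),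
    ∀ (U : Rep.{u} k G) (i : U ⟶ D.X 0) (r : D.X 0 ⟶ U), Indecomposable U →
      (∀ g ∈ P, ∀ v, U.ρ g v = v) → i ≫ r = 𝟙 U → IsIso (i ≫ (R.r ≫ R.i) ≫ r) := by
  obtain ⟨h, h', hh⟩ := hom_inv_eq P e 0
  have hz : ∀ i : ℤ, i ≠ 0 → IsZero ((trivialComplex k (G ⧸ P)).X i) := fun i hi =>
    HomologicalComplex.isZero_single_obj_X (ComplexShape.down ℤ) 0 _ i hi
  have hid : e.inv.f 0 ≫ e.hom.f 0 = 𝟙 ((trivialComplex k (G ⧸ P)).X 0) := by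
    have h1 := e.homotopyInvHomId.comm 0
    rw [dNext_eq (i := (0 : ℤ)) (i' := -1) _ (by simp), prevD_eq (j := (0 : ℤ)) (j' := 1) _ (by simp),
      (hz (-1) (by omega)).eq_of_src (e.homotopyInvHomId.hom _ _) 0,
      (hz 1 (by omega)).eq_of_tgt (e.homotopyInvHomId.hom _ _) 0, comp_zero, zero_comp, zero_add,
      zero_add] at h1
    exact h1
  obtain ⟨a, ha⟩ : ∃ a : (brauer k P).obj (D.X 0) ⟶ (trivialComplex k (G ⧸ P)).X 0,
    a = e.hom.f 0 := ⟨_, rfl⟩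
  obtain ⟨c, hc⟩ : ∃ c : (trivialComplex k (G ⧸ P)).X 0 ⟶ (brauer k P).obj (D.X 0),
    c = e.inv.f 0 := ⟨_, rfl⟩
  replace hid : c ≫ a = 𝟙 _ := by rw [ha, hc]; exact hid
  replace hh : a ≫ c = (brauer k P).map (D.d 0 (0 - 1)) ≫ h +
      h' ≫ (brauer k P).map (D.d (0 + 1) 0) + 𝟙 _ := by rw [ha, hc]; exact hh
  let s : (brauer k P).obj (Rep.trivial k G k) ≅ (trivialComplex k (G ⧸ P)).X 0 :=
    brauerTrivialIso (p := p) P hP ≪≫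
      (HomologicalComplex.singleObjXSelf (ComplexShape.down ℤ) 0 (Rep.trivial k (G ⧸ P) k)).symm
  -- Fullness lifts the components of `e` in degree zero to maps between `k` and `D_0`, and
  -- faithfulness on trivial modules shows that the lifts split.
  obtain ⟨α, hα⟩ := exists_brauer_map_eq (isPPermutation_trivial p) (hD 0) P hP
    (s.hom ≫ c)
  obtain ⟨β, hβ⟩ := exists_brauer_map_eq (hD 0) (isPPermutation_trivial p) P hP
    (a ≫ s.inv)
  have hαβ : α ≫ β = 𝟙 _ := by
    rw [← sub_eq_zero]
    refine eq_zero_of_brauer_map_eq_zero P hP (fun _ _ _ => rfl) (fun _ _ _ => rfl) _ ?_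
    rw [Functor.map_sub, Functor.map_comp, CategoryTheory.Functor.map_id, hα, hβ, Category.assoc,
      ← Category.assoc c, hid, Category.id_comp, s.hom_inv_id, sub_self]
  refine ⟨⟨α, β, hαβ⟩, fun U i r hU hPU hir => ?_⟩
  refine isIso_of_brauer_map_eq hD hmin P hP (β ≫ α) h h' ?_ hU hPU i r hir
  rw [← hh, Functor.map_comp, hα, hβ, Category.assoc, ← Category.assoc s.inv, s.inv_hom_id,
    Category.id_comp]

end Brauer

end Rep

/-! ### The two cases of the theorem. -/

namespace Rep

open Representation

variable {k : Type u} {G : Type u} [Field k] [Group G] [Finite G] {p : ℕ} [Fact p.Prime] [CharP k p]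

theorem isRelProjectiveSet_of_forall_normal (h : ∀ P : Subgroup G, P.Normal → IsPGroup p P → P = ⊥)
    (M : Rep.{u} k G) [Module.Finite k M.V] : IsRelProjectiveSet (corefreePSubgroups p G) M := by
  rintro U - ⟨R⟩
  have : Module.Finite k U.V := finite_of_retract R
  obtain ⟨S⟩ : Nonempty (Sylow p G) := inferInstance
  exact ⟨S, ⟨S.isPGroup', fun N hN hNS => h N hN (S.isPGroup'.to_le hNS)⟩,
    isRelProjective_sylow p S U⟩

theorem exists_sum_of_forall_normal (h : ∀ P : Subgroup G, P.Normal → IsPGroup p P → P = ⊥)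
    (C : ChainComplex (Rep.{u} k G) ℤ) (hC : IsEndotrivial p C) :
    ∃ i : ℤ, (∀ j : ℤ, j ≠ i → IsRelProjectiveSet (corefreePSubgroups p G) (C.X j)) ∧
        ∃ M N : Rep.{u} k G,
          Nonempty (C.X i ≅ M ⊞ N) ∧
          IsRelProjectiveSet (corefreePSubgroups p G) M ∧
          Indecomposable N ∧
          ∀ P : Subgroup G, IsVertex P N ↔ ∃ S : Sylow p G, (S : Subgroup G) = P := by
  have hfin : ∀ j, Module.Finite k (C.X j).V := fun j => (hC.1.2 j).1
  obtain ⟨i, γ, hγ⟩ := hC.exists_trace_ne_zero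
  obtain ⟨N, R, δ, hN, hδ⟩ := exists_indecomposable_retract_trace_ne_zero γ hγ
  obtain ⟨M, m, q, hmq, hsum, -⟩ := R.exists_complement
  have : Module.Finite k M.V := finite_of_retract ⟨m, q, hmq⟩
  have : Module.Finite k N.V := finite_of_retract R
  exact ⟨i, fun j _ => isRelProjectiveSet_of_forall_normal h (C.X j), M, N,
    ⟨isoBiprod m q R.i R.r hmq R.retract hsum⟩, isRelProjectiveSet_of_forall_normal h M, hN,
    isVertex_iff_of_trace_ne_zero δ hδ⟩

theorem isVertex_trivial_iff (P : Subgroup G) :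
    IsVertex P (Rep.trivial k G k) ↔ ∃ S : Sylow p G, (S : Subgroup G) = P := by
  have : Module.Finite k (Rep.trivial k G k).V := inferInstanceAs (Module.Finite k k)
  refine isVertex_iff_of_trace_ne_zero (𝟙 _) ?_ P
  have h1 : LinearMap.trace k k LinearMap.id ≠ 0 := by simp
  exact h1

theorem exists_sum_of_normal {P₀ : Subgroup G} (hP₀n : P₀.Normal) (hP₀ : IsPGroup p P₀)
    (hP₀1 : P₀ ≠ ⊥) (C : ChainComplex (Rep.{u} k G) ℤ) (hC : IsFaithfulEndotrivial p C) :
    ∃ D : ChainComplex (Rep.{u} k G) ℤ,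
      IsBoundedPPermutation p D ∧ Nonempty (HomotopyEquiv C D) ∧
        (∀ j : ℤ, j ≠ 0 → IsRelProjectiveSet (corefreePSubgroups p G) (D.X j)) ∧
        ∃ M : Rep.{u} k G,
          Nonempty (D.X 0 ≅ M ⊞ Rep.trivial k G k) ∧
          IsRelProjectiveSet (corefreePSubgroups p G) M := by
  obtain ⟨D, hD, ⟨eCD⟩, hmin⟩ := exists_minimal C hC.1.1
  have heq : ∀ (P : Subgroup G) [P.Normal], IsPGroup p P → P ≠ ⊥ →
      Nonempty (HomotopyEquiv (((brauer k P).mapHomologicalComplex (ComplexShape.down ℤ)).obj D)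
        (trivialComplex k (G ⧸ P))) := by
    intro P _ hP hP1
    obtain ⟨e⟩ := hC.2 P hP hP1
    exact ⟨((brauer k P).mapHomotopyEquiv eCD.symm).trans e⟩
  obtain ⟨e₀⟩ := heq P₀ hP₀ hP₀1
  obtain ⟨R₀, hR₀⟩ := exists_trivial_retract hD.2 hmin P₀ hP₀ e₀
  obtain ⟨M, m, q, hmq, hsum, hm⟩ := R₀.exists_complement
  refine ⟨D, hD, ⟨eCD⟩, fun j hj => ?_, M, ⟨isoBiprod m q R₀.i R₀.r hmq R₀.retract hsum⟩, ?_⟩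
  · rintro U hU ⟨R⟩
    rcases isRelProjective_or_acts_trivially hU ((hD.2 j).of_retract R) with h |
      ⟨P, hPn, hP, hP1, hPU⟩
    · exact h
    · obtain ⟨e⟩ := heq P hP hP1
      exact (not_retract_of_acts_trivially hD.2 hmin P hP e hj hU hPU R).elim
  · rintro U hU ⟨R⟩
    let R' : Retract U (D.X 0) := R.trans ⟨m, q, hmq⟩
    rcases isRelProjective_or_acts_trivially hU ((hD.2 0).of_retract R') with h |
      ⟨P, hPn, hP, hP1, hPU⟩
    · exact h
    exfalso
    obtain ⟨e⟩ := heq P hP hP1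
    obtain ⟨R₁, hR₁⟩ := exists_trivial_retract hD.2 hmin P hP e
    have h1 := hR₁ U R'.i R'.r hU hPU R'.retract
    -- The automorphism `h1` of `U` factors through `k`, so `U` embeds in the trivial module. Hence
    -- `P₀` acts trivially on `U` as well, which allows a return from `P` to the fixed retract `R₀`.
    have hinj : Function.Injective (R'.i ≫ R₁.r).hom := by
      have h2 := (bijective_of_isIso (R'.i ≫ (R₁.r ≫ R₁.i) ≫ R'.r)).1
      intro x y hxy
      exact h2 (congrArg (fun z => R'.r.hom (R₁.i.hom z)) hxy)
    have hP₀U : ∀ g ∈ P₀, ∀ v, U.ρ g v = v := by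
      intro g _ v
      apply hinj
      rw [Rep.hom_comm_apply]
      rfl
    have h3 := hR₀ U R'.i R'.r hU hP₀U R'.retract
    -- `U` is a summand of the complement `M`, on which the retraction `R₀.r` vanishes.
    have h4 : R'.i ≫ (R₀.r ≫ R₀.i) ≫ R'.r = 0 := by
      change (R.i ≫ m) ≫ (R₀.r ≫ R₀.i) ≫ R'.r = 0
      simp only [Category.assoc]
      rw [← Category.assoc m, hm, zero_comp, comp_zero]
    rw [h4] at h3
    exact hU.1 (IsZero.of_mono_zero U U)

end Rep

theorem mainTheorem12 (p : ℕ) [Fact p.Prime] (k : Type u) [Field k] [CharP k p]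
    (G : Type u) [Group G] [Finite G]
    (C : ChainComplex (Rep.{u} k G) ℤ) (hC : IsFaithfulEndotrivial p C) :
    ∃ D : ChainComplex (Rep.{u} k G) ℤ,
      IsBoundedPPermutation p D ∧ Nonempty (HomotopyEquiv C D) ∧
      ∃ i : ℤ,
        (∀ j : ℤ, j ≠ i → IsRelProjectiveSet (corefreePSubgroups p G) (D.X j)) ∧
        ∃ M N : Rep.{u} k G,
          Nonempty (D.X i ≅ M ⊞ N) ∧
          IsRelProjectiveSet (corefreePSubgroups p G) M ∧
          Indecomposable N ∧
          ∀ P : Subgroup G, IsVertex P N ↔ ∃ S : Sylow p G, (S : Subgroup G) = P := by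
  by_cases h : ∀ P : Subgroup G, P.Normal → IsPGroup p P → P = ⊥
  · exact ⟨C, hC.1.1, ⟨HomotopyEquiv.refl C⟩, Rep.exists_sum_of_forall_normal h C hC.1⟩
  · push Not at h
    obtain ⟨P₀, hn, hp, h1⟩ := h
    obtain ⟨D, hD, e, hj, M, hM, hM'⟩ := Rep.exists_sum_of_normal hn hp h1 C hC
    exact ⟨D, hD, e, 0, hj, M, _, hM, hM', Rep.indecomposable_trivial, Rep.isVertex_trivial_iff⟩
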